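/- **Theorem.** All graphs are finite, simple, undirected and connected. For a graph $G=(V,E)$ let $n=|V|$ and let $D_G$ be its diameter. A labeling is a function $\lambda:E\to 2^{\mathbb N\setminus\{0\}}$; its size is $|\lambda|=\sum_{e\in E}|\lambda(e)|$ and its lifetime is its largest label. It is temporally connected if for all distinct vertices $u,v$ there are a path $e_1,\dots,e_k$ in $G$ from $u$ to $v$ and labels $t_i\in\lambda(e_i)$ with $t_1<\dots<t_k$. The Minimum Aged Labeling problem (MAL) asks, given $G$ and a natural number $a$, for a temporally connected labeling of lifetime at most $a$ and of minimum size. An $O(f)$-approximation algorithm is a deterministic algorithm, with running time polynomial in the size of the input, for which there is an absolute constant $C$ such that on each instance considered it returns a temporally connected labeling $\lambda$ of lifetime at most $a$ with $|\lambda|\le C\cdot f\cdot|\lambda^*|$, where $\lambda^*$ is an optimal solution of the instance. 1. There is a polynomial-time $O(\sqrt{n\log n})$-approximation algorithm for MAL on the instances $(G,a)$ with $a\ge\lceil \tfrac32 D_G\rceil$. 2. There is a polynomial-time $O\big(\sqrt[3]{D_G\,n\log^2 n}\big)$-approximation algorithm for MAL on the instances $(G,a)$ with $a\ge\lceil \tfrac53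 D_G\rceil$. In both cases the running time can be bounded by a polynomial in $n$ alone, independently of $a$. -/

import Mathlib

namespace AgedLabeling

/-! ### Temporal graphs -/

/-- A labeling assigns to every edge of `G` a finite set of labels. Infinite label sets are
irrelevant here, because all labels of a labeling of bounded lifetime are bounded. -/
abbrev Labeling {V : Type*} (G : SimpleGraph V) : Type _ :=
  G.edgeSet → Finset ℕ

/-- The set of labels of an unordered pair (empty if the pair is not an edge). -/
noncomputable def Labeling.at {V : Type*} {G : SimpleGraph V} (lam : Labeling G) (e : Sym2 V) :
    Finset ℕ :=
  open Classical in if h : e ∈ G.edgeSet then lam ⟨e, h⟩ else ∅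

/-- The total number of labels, `∑ e, |lam e|`. -/
noncomputable def Labeling.size {V : Type*} [Fintype V] {G : SimpleGraph V} (lam : Labeling G) :
    ℕ :=
  open Classical in ∑ e : G.edgeSet, (lam e).card

/-- The lifetime (age): the largest label used (`0` if there is no label at all). -/
noncomputable def Labeling.lifetime {V : Type*} [Fintype V] {G : SimpleGraph V}
    (lam : Labeling G) : ℕ :=
  open Classical in (Finset.univ : Finset G.edgeSet).sup fun e => (lam e).sup id

/-- `TemporallyReachable lam u v`: there is a (strict) temporal path from `u` to `v`, that is, a
path `e₁, …, e_k` of `G` from `u` to `v` with labels `tᵢ ∈ lam eᵢ` and `t₁ < ⋯ < t_k`. -/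
def TemporallyReachable {V : Type*} {G : SimpleGraph V} (lam : Labeling G) (u v : V) : Prop :=
  ∃ p : G.Walk u v, p.IsPath ∧
    ∃ ts : List ℕ, List.Forall₂ (fun e t => t ∈ lam.at e) p.edges ts ∧ ts.Pairwise (· < ·)

/-- Every vertex is temporally reachable from every other vertex. -/
def TemporallyConnected {V : Type*} {G : SimpleGraph V} (lam : Labeling G) : Prop :=
  ∀ u v : V, u ≠ v → TemporallyReachable lam u v

/-- Feasible solutions of the instance `(G, a)` of Minimum Aged Labeling: the labels are positive,
the lifetime is at most `a`, and the temporal graph is temporally connected. -/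
def Feasible {V : Type*} [Fintype V] (G : SimpleGraph V) (a : ℕ) (lam : Labeling G) : Prop :=
  (∀ e, ∀ t ∈ lam e, 0 < t) ∧ lam.lifetime ≤ a ∧ TemporallyConnected lam

/-! ### The machine model

A random access machine, programmed in a structured language: natural number registers, arrays
with two subscripts, truncated subtraction, addition and comparisons as the only arithmetic, and
one time unit for each elementary operation. (Multiplication is not an elementary operation, so a
run of `t` steps only handles numbers with `O(t)` bits more than the input, and time bounds agree
with those of Turing machines up to a polynomial.) -/

/-- The contents of the memory: `reg x` is the value of register number `x`, and `arr A i j` is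
the value of the entry `(i, j)` of array number `A`. -/
structure State where
  reg : ℕ → ℕ
  arr : ℕ → ℕ → ℕ → ℕ

inductive Expr where
  | num (c : ℕ)
  | reg (x : ℕ)
  | get (A : ℕ) (i j : Expr)
  | add (e₁ e₂ : Expr)
  | sub (e₁ e₂ : Expr)
  | lt (e₁ e₂ : Expr)
  | eq (e₁ e₂ : Expr)

/-- The value of an expression; truth values are `1` and `0`. -/
def Expr.eval (s : State) : Expr → ℕ
  | num c => c
  | reg x => s.reg x
  | get A i j => s.arr A (i.eval s) (j.eval s)
  | add e₁ e₂ => e₁.eval s + e₂.eval s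
  | sub e₁ e₂ => e₁.eval s - e₂.eval s
  | lt e₁ e₂ => if e₁.eval s < e₂.eval s then 1 else 0
  | eq e₁ e₂ => if e₁.eval s = e₂.eval s then 1 else 0

/-- The number of elementary operations in the evaluation of an expression. -/
def Expr.cost : Expr → ℕ
  | num _ => 1
  | reg _ => 1
  | get _ i j => i.cost + j.cost + 1
  | add e₁ e₂ => e₁.cost + e₂.cost + 1
  | sub e₁ e₂ => e₁.cost + e₂.cost + 1
  | lt e₁ e₂ => e₁.cost + e₂.cost + 1
  | eq e₁ e₂ => e₁.cost + e₂.cost + 1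

/-- Programs. Register and array numbers are fixed in the program text; subscripts are computed. -/
inductive Prog where
  | skip
  | assign (x : ℕ) (e : Expr)
  | store (A : ℕ) (i j e : Expr)
  | seq (P Q : Prog)
  | ite (e : Expr) (P Q : Prog)
  | while (e : Expr) (P : Prog)

/-- The memory after `reg x := c`. -/
def State.setReg (s : State) (x c : ℕ) : State :=
  { s with reg := fun y => if y = x then c else s.reg y }

/-- The memory after `arr A i j := c`. -/
def State.setArr (s : State) (A i j c : ℕ) : State :=
  { s with arr := fun B k l => if B = A ∧ k = i ∧ l = j then c else s.arr B k l }

/-- `Exec P s s' t`: started in memory `s`, the program `P` halts with memory `s'` after exactly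
`t` steps. -/
inductive Exec : Prog → State → State → ℕ → Prop where
  | skip (s : State) : Exec .skip s s 1
  | assign (s : State) (x : ℕ) (e : Expr) :
      Exec (.assign x e) s (s.setReg x (e.eval s)) (e.cost + 1)
  | store (s : State) (A : ℕ) (i j e : Expr) :
      Exec (.store A i j e) s (s.setArr A (i.eval s) (j.eval s) (e.eval s))
        (i.cost + j.cost + e.cost + 1)
  | seq {P Q : Prog} {s s' s'' : State} {t t' : ℕ} :
      Exec P s s' t → Exec Q s' s'' t' → Exec (.seq P Q) s s'' (t + t')
  | ite_true {e : Expr} {P Q : Prog} {s s' : State} {t : ℕ} :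
      e.eval s ≠ 0 → Exec P s s' t → Exec (.ite e P Q) s s' (e.cost + 1 + t)
  | ite_false {e : Expr} {P Q : Prog} {s s' : State} {t : ℕ} :
      e.eval s = 0 → Exec Q s s' t → Exec (.ite e P Q) s s' (e.cost + 1 + t)
  | while_true {e : Expr} {P : Prog} {s s' s'' : State} {t t' : ℕ} :
      e.eval s ≠ 0 → Exec P s s' t → Exec (.while e P) s' s'' t' →
        Exec (.while e P) s s'' (e.cost + 1 + t + t')
  | while_false {e : Expr} {P : Prog} {s : State} :
      e.eval s = 0 → Exec (.while e P) s s (e.cost + 1)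

/-- Programs are deterministic: the final memory and the number of steps are unique. -/
theorem Exec.deterministic {P : Prog} {s s₁ s₂ : State} {t₁ t₂ : ℕ}
    (h₁ : Exec P s s₁ t₁) (h₂ : Exec P s s₂ t₂) : s₁ = s₂ ∧ t₁ = t₂ := by
  induction h₁ generalizing s₂ t₂ with
  | skip s => cases h₂; exact ⟨rfl, rfl⟩
  | assign s x e => cases h₂; exact ⟨rfl, rfl⟩
  | store s A i j e => cases h₂; exact ⟨rfl, rfl⟩
  | seq _ _ ihP ihQ =>
    cases h₂ with
    | seq k₁ k₂ =>
      obtain ⟨rfl, rfl⟩ := ihP k₁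
      obtain ⟨rfl, rfl⟩ := ihQ k₂
      exact ⟨rfl, rfl⟩
  | ite_true he _ ih =>
    cases h₂ with
    | ite_true _ k => obtain ⟨rfl, rfl⟩ := ih k; exact ⟨rfl, rfl⟩
    | ite_false he' _ => exact absurd he' he
  | ite_false he _ ih =>
    cases h₂ with
    | ite_true he' _ => exact absurd he he'
    | ite_false _ k => obtain ⟨rfl, rfl⟩ := ih k; exact ⟨rfl, rfl⟩
  | while_true he _ _ ihP ihW =>
    cases h₂ with
    | while_true _ k₁ k₂ =>
      obtain ⟨rfl, rfl⟩ := ihP k₁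
      obtain ⟨rfl, rfl⟩ := ihW k₂
      exact ⟨rfl, rfl⟩
    | while_false he' => exact absurd he' he
  | while_false he =>
    cases h₂ with
    | while_true he' _ _ => exact absurd he he'
    | while_false _ => exact ⟨rfl, rfl⟩

/-! ### Approximation algorithms -/

/-- The input: `n` in register `0`, `a` in register `1`, the adjacency matrix of `G` in array `0`,
and zero everywhere else. -/
noncomputable def input {n : ℕ} (G : SimpleGraph (Fin n)) (a : ℕ) : State where
  reg x := if x = 0 then n else if x = 1 then a else 0
  arr A i j := open Classical in
    if A = 0 ∧ ∃ (hi : i < n) (hj : j < n), G.Adj ⟨i, hi⟩ ⟨j, hj⟩ then 1 else 0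

/-- The memory `s` holds `lam` as output: register `0` contains the length of a list of triples
`(u, v, t)`, whose `i`-th member is in the entries `(i, 0)`, `(i, 1)`, `(i, 2)` of array `1`. In
each triple `uv` is an edge, and `t ∈ lam e` if and only if some triple `(u, v, t)` with `e = uv`
is in the list. -/
def State.Outputs {n : ℕ} {G : SimpleGraph (Fin n)} (s : State) (lam : Labeling G) : Prop :=
  (∀ i < s.reg 0, ∃ u v : Fin n, G.Adj u v ∧ s.arr 1 i 0 = u ∧ s.arr 1 i 1 = v) ∧
  ∀ (u v : Fin n) (h : s(u, v) ∈ G.edgeSet) (t : ℕ), t ∈ lam ⟨s(u, v), h⟩ ↔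
    ∃ i < s.reg 0, s.arr 1 i 2 = t ∧
      ((s.arr 1 i 0 = u ∧ s.arr 1 i 1 = v) ∨ (s.arr 1 i 0 = v ∧ s.arr 1 i 1 = u))

/-- There is a polynomial-time `O(f)`-approximation algorithm for Minimum Aged Labeling on the
instances `(G, a)`, `G` connected, that satisfy `adm`: one program, one polynomial `p` and one
constant `C` such that on each such instance the program halts after at most `p n` steps, where `n`
is the number of vertices, and outputs a feasible labeling whose number of labels is at most
`C * f G` times that of any feasible labeling (hence of an optimal one). -/
def HasPolyTimeApprox (adm : ∀ n : ℕ, SimpleGraph (Fin n) → ℕ → Prop)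
    (f : ∀ n : ℕ, SimpleGraph (Fin n) → ℝ) : Prop :=
  ∃ (P : Prog) (p : Polynomial ℕ) (C : ℝ),
    ∀ (n : ℕ) (G : SimpleGraph (Fin n)) (a : ℕ), G.Connected → adm n G a →
      ∃ (s : State) (t : ℕ), Exec P (input G a) s t ∧ t ≤ p.eval n ∧
        ∃ lam : Labeling G, s.Outputs lam ∧ Feasible G a lam ∧
          ∀ mu : Labeling G, Feasible G a mu → (lam.size : ℝ) ≤ C * f n G * mu.size

end AgedLabeling

/-! The labeled edges of a feasible labeling form a connected spanning graph, so every feasible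
labeling has at least n - 1 labels (`Feasible.card_le_size_add_one`). It therefore suffices to
construct a feasible labeling with O(n f) labels.

The labeling is built in three phases from two vertex sets S and T (`Scheme`). During the first r
time units every vertex walks to a nearest vertex of S; during the next D = diam G units each s in S
reaches T inside a tree of shortest paths; afterwards T spreads to all vertices. The first and last
phases need at most n labels each, the middle one at most min(|S| n, |S| |T| D), and the lifetime is
at most r + D plus the largest distance from T.

Let ρ = ⌊D / q⌋, let B be a smallest ball of radius ρ, with k elements, and let A be a greedy set
whose balls of radius ρ cover the graph. Every vertex is within D - ρ of B, because a shortest path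
from the centre has spent ρ steps when it leaves the ball (`setDist_ballSet_le`). Since all balls
have at least k elements, averaging gives |A| ≤ n log n / k + 1 (`card_greedy_card_le`). Hence B and
A cannot both be large.

For 3/2, take q = 2, T = V and the smaller of B and A as S: min(k, |A|) is O(√(n log n)). For 5/3,
take q = 3 and the cheaper of S = B, T = V (at most n k middle labels) and S = T = A (at most |A|²
D): the minimum is O(n (D n log² n)^(1/3)).

The algorithm is written in a language of terms with sums over the vertices (`Term`) and of table
assignments with loops of n rounds (`Cmd`). Its compilation halts in time polynomial in n
(`Term.correct`, `Cmd.halts_compile`). The bound a is never read: the labeling depends on G only,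
and a matters only for feasibility. `exists_scheme` joins the program and the combinatorics. -/

namespace AgedLabeling

/-! ### A small table language, its compilation and its running time. -/

open Polynomial

/-! ### Time-bounded execution -/

/-- Started in `s`, the program `P` halts within `T` steps in a state satisfying `Q`. -/
def Halts (P : Prog) (s : State) (T : ℕ) (Q : State → Prop) : Prop :=
  ∃ s' t, Exec P s s' t ∧ t ≤ T ∧ Q s'

theorem Halts.mono {P : Prog} {s : State} {T T' : ℕ} {Q Q' : State → Prop} (h : Halts P s T Q)
    (hT : T ≤ T') (hQ : ∀ s', Q s' → Q' s') : Halts P s T' Q' := by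
  obtain ⟨s', t, he, ht, hq⟩ := h
  exact ⟨s', t, he, ht.trans hT, hQ _ hq⟩

theorem Halts.seq {P P' : Prog} {s : State} {T T' : ℕ} {Q Q' : State → Prop} (h : Halts P s T Q)
    (h' : ∀ s', Q s' → Halts P' s' T' Q') : Halts (.seq P P') s (T + T') Q' := by
  obtain ⟨s', t, he, ht, hq⟩ := h
  obtain ⟨s'', t', he', ht', hq'⟩ := h' s' hq
  exact ⟨s'', t + t', .seq he he', add_le_add ht ht', hq'⟩

theorem Halts.assign {s : State} {x : ℕ} {e : Expr} {T : ℕ} {Q : State → Prop}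
    (hT : e.cost + 1 ≤ T) (hQ : Q (s.setReg x (e.eval s))) : Halts (.assign x e) s T Q :=
  ⟨_, _, .assign s x e, hT, hQ⟩

theorem Halts.store {s : State} {A : ℕ} {i j e : Expr} {T : ℕ} {Q : State → Prop}
    (hT : i.cost + j.cost + e.cost + 1 ≤ T)
    (hQ : Q (s.setArr A (i.eval s) (j.eval s) (e.eval s))) : Halts (.store A i j e) s T Q :=
  ⟨_, _, .store s A i j e, hT, hQ⟩

/-- The bound adds the times of both branches instead of taking their maximum, so that time bounds
stay polynomials with natural coefficients. -/
theorem Halts.ite {e : Expr} {P P' : Prog} {s : State} {T T' : ℕ} {Q : State → Prop}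
    (h : e.eval s ≠ 0 → Halts P s T Q) (h' : e.eval s = 0 → Halts P' s T' Q) :
    Halts (.ite e P P') s (e.cost + 1 + (T + T')) Q := by
  by_cases he : e.eval s = 0
  · obtain ⟨s', t, hx, ht, hq⟩ := h' he
    exact ⟨s', _, .ite_false he hx, by omega, hq⟩
  · obtain ⟨s', t, hx, ht, hq⟩ := h he
    exact ⟨s', _, .ite_true he hx, by omega, hq⟩

@[simp] theorem State.setReg_arr (s : State) (x c : ℕ) : (s.setReg x c).arr = s.arr := rfl

theorem State.setReg_reg (s : State) (x c y : ℕ) :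
    (s.setReg x c).reg y = if y = x then c else s.reg y := rfl

theorem State.setArr_arr (s : State) (A i j c B k l : ℕ) :
    (s.setArr A i j c).arr B k l = if B = A ∧ k = i ∧ l = j then c else s.arr B k l := rfl

/-- The loop `for x := 0, …, reg 0 - 1 do P`. -/
def forLoop (x : ℕ) (P : Prog) : Prog :=
  .seq (.assign x (.num 0))
    (.while (.lt (.reg x) (.reg 0)) (.seq P (.assign x (.add (.reg x) (.num 1)))))

/-- Each round costs 4 for the test and 4 for the increment besides the body; the initial assignment
costs 2 and the failing last test 4. -/
theorem Halts.forLoop {x N T : ℕ} {P : Prog} {Inv : ℕ → State → Prop} {s : State}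
    (h0 : Inv 0 (s.setReg x 0))
    (hN : ∀ i s, Inv i s → s.reg 0 = N ∧ s.reg x = i)
    (hP : ∀ i s, i < N → Inv i s → Halts P s T fun s' => Inv (i + 1) (s'.setReg x (s'.reg x + 1))) :
    Halts (forLoop x P) s (N * (T + 8) + 6) (Inv N) := by
  have key : ∀ m i s, i + m = N → Inv i s →
      Halts (.while (.lt (.reg x) (.reg 0)) (.seq P (.assign x (.add (.reg x) (.num 1))))) s
        (m * (T + 8) + 4) (Inv N) := by
    intro m
    induction m with
    | zero =>
      intro i s hi hs
      obtain ⟨h1, h2⟩ := hN i s hs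
      refine ⟨s, _, .while_false ?_, ?_, ?_⟩
      · simp only [Expr.eval, h1, h2]; rw [if_neg (by omega)]
      · simp [Expr.cost]
      · rwa [show N = i by omega]
    | succ m ih =>
      intro i s hi hs
      obtain ⟨h1, h2⟩ := hN i s hs
      obtain ⟨s', t, he, ht, hq⟩ := hP i s (by omega) hs
      obtain ⟨s'', t', he', ht', hq'⟩ := ih (i + 1) _ (by omega) hq
      refine ⟨s'', _, .while_true ?_ (.seq he (.assign _ _ _)) he', ?_, hq'⟩
      · simp only [Expr.eval, h1, h2]; rw [if_pos (by omega)]; simp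
      · simp only [Expr.cost]; rw [Nat.succ_mul]; omega
  have := Halts.seq (T := 2) (P := .assign x (.num 0)) (s := s) (Q := Inv 0)
    (.assign le_rfl h0) (fun s' hs' => key N 0 s' (by omega) hs')
  exact this.mono (by omega) fun _ h => h

/-! ### Terms -/

/-- Arithmetical terms over tables of numbers, with sums over `{0, …, n - 1}`. Variables are
de Bruijn indices. -/
inductive Term where
  | num (c : ℕ)
  | var (v : ℕ)
  | get (A : ℕ) (i j : Term)
  | add (e f : Term)
  | sub (e f : Term)
  | lt (e f : Term)
  | eq (e f : Term)
  | ite (c e f : Term)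
  | sum (e : Term)

/-- Extension of an assignment of the variables by a value of the variable `0`. -/
def scons (x : ℕ) (ρ : ℕ → ℕ) : ℕ → ℕ
  | 0 => x
  | v + 1 => ρ v

@[simp] theorem scons_zero (x : ℕ) (ρ : ℕ → ℕ) : scons x ρ 0 = x := rfl

@[simp] theorem scons_succ (x : ℕ) (ρ : ℕ → ℕ) (v : ℕ) : scons x ρ (v + 1) = ρ v := rfl

@[simp] theorem scons_one (x : ℕ) (ρ : ℕ → ℕ) : scons x ρ 1 = ρ 0 := rfl

@[simp] theorem scons_two (x : ℕ) (ρ : ℕ → ℕ) : scons x ρ 2 = ρ 1 := rfl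

@[simp] theorem scons_three (x : ℕ) (ρ : ℕ → ℕ) : scons x ρ 3 = ρ 2 := rfl

/-- The contents of a collection of tables. -/
abbrev Mem := ℕ → ℕ → ℕ → ℕ

/-- The value of a term. -/
def Term.val (n : ℕ) (M : Mem) : Term → (ℕ → ℕ) → ℕ
  | num c, _ => c
  | var v, ρ => ρ v
  | get A i j, ρ => M A (i.val n M ρ) (j.val n M ρ)
  | add e f, ρ => e.val n M ρ + f.val n M ρ
  | sub e f, ρ => e.val n M ρ - f.val n M ρ
  | lt e f, ρ => if e.val n M ρ < f.val n M ρ then 1 else 0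
  | eq e f, ρ => if e.val n M ρ = f.val n M ρ then 1 else 0
  | ite c e f, ρ => if c.val n M ρ ≠ 0 then e.val n M ρ else f.val n M ρ
  | sum e, ρ => ∑ i : Fin n, e.val n M (scons i ρ)

/-- A program that computes the value of a term in register `b`, using registers from `b` on.
The variable `v` is stored in register `σ v`, and the table `A` in array `α A`. -/
def Term.compile (α : ℕ → ℕ) : Term → (ℕ → ℕ) → ℕ → Prog
  | num c, _, b => .assign b (.num c)
  | var v, σ, b => .assign b (.reg (σ v))
  | get A i j, σ, b => .seq (i.compile α σ b) (.seq (j.compile α σ (b + 1))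
      (.assign b (.get (α A) (.reg b) (.reg (b + 1)))))
  | add e f, σ, b => .seq (e.compile α σ b) (.seq (f.compile α σ (b + 1))
      (.assign b (.add (.reg b) (.reg (b + 1)))))
  | sub e f, σ, b => .seq (e.compile α σ b) (.seq (f.compile α σ (b + 1))
      (.assign b (.sub (.reg b) (.reg (b + 1)))))
  | lt e f, σ, b => .seq (e.compile α σ b) (.seq (f.compile α σ (b + 1))
      (.assign b (.lt (.reg b) (.reg (b + 1)))))
  | eq e f, σ, b => .seq (e.compile α σ b) (.seq (f.compile α σ (b + 1))
      (.assign b (.eq (.reg b) (.reg (b + 1)))))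
  | ite c e f, σ, b => .seq (c.compile α σ b)
      (.ite (.reg b) (e.compile α σ b) (f.compile α σ b))
  | sum e, σ, b => .seq (.assign b (.num 0))
      (forLoop (b + 1) (.seq (e.compile α (scons (b + 1) σ) (b + 2))
        (.assign b (.add (.reg b) (.reg (b + 2))))))

/-- A bound for the running time of the program of a term. -/
noncomputable def Term.time : Term → Polynomial ℕ
  | num _ => 2
  | var _ => 2
  | get _ e f => e.time + (f.time + 4)
  | add e f => e.time + (f.time + 4)
  | sub e f => e.time + (f.time + 4)
  | lt e f => e.time + (f.time + 4)
  | eq e f => e.time + (f.time + 4)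
  | ite c e f => c.time + (2 + (e.time + f.time))
  | sum e => 2 + (X * (e.time + 4 + 8) + 6)

/-- `s'` has the same arrays as `s`, and the same registers below `b`. -/
def State.AgreeBelow (b : ℕ) (s s' : State) : Prop :=
  s'.arr = s.arr ∧ ∀ x < b, s'.reg x = s.reg x

theorem State.AgreeBelow.trans {b b' : ℕ} {s s' s'' : State} (h : s.AgreeBelow b s')
    (h' : s'.AgreeBelow b' s'') (hb : b ≤ b') : s.AgreeBelow b s'' :=
  ⟨h'.1.trans h.1, fun x hx => (h'.2 x (hx.trans_le hb)).trans (h.2 x hx)⟩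

theorem State.AgreeBelow.setReg {b : ℕ} {s s' : State} (h : s.AgreeBelow b s') {x : ℕ} (hx : b ≤ x)
    (c : ℕ) : s.AgreeBelow b (s'.setReg x c) :=
  ⟨h.1, fun y hy => by rw [State.setReg_reg, if_neg (by omega), h.2 y hy]⟩

theorem State.AgreeBelow.refl (b : ℕ) (s : State) : s.AgreeBelow b s := ⟨rfl, fun _ _ => rfl⟩

theorem Halts.binary {P P' : Prog} {b m m' k T T' : ℕ} {s : State} {e : Expr}
    (h : Halts P s T fun s' => s.AgreeBelow b s' ∧ s'.reg b = m)
    (h' : ∀ s', s.AgreeBelow b s' →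
      Halts P' s' T' fun s'' => s'.AgreeBelow (b + 1) s'' ∧ s''.reg (b + 1) = m')
    (he : ∀ s', s'.arr = s.arr → s'.reg b = m → s'.reg (b + 1) = m' → e.eval s' = k)
    (hc : e.cost = 3) :
    Halts (.seq P (.seq P' (.assign b e))) s (T + (T' + 4)) fun s' =>
      s.AgreeBelow b s' ∧ s'.reg b = k := by
  refine h.seq fun s₁ h₁ => (h' s₁ h₁.1).seq fun s₂ h₂ => ?_
  refine Halts.assign (by omega) ⟨(h₁.1.trans h₂.1 (by omega)).setReg le_rfl _, ?_⟩
  rw [State.setReg_reg, if_pos rfl]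
  exact he _ (h₂.1.1.trans h₁.1.1) ((h₂.1.2 b (by omega)).trans h₁.2) h₂.2

/-- The tables stored in a memory. -/
def State.mem (α : ℕ → ℕ) (s : State) : Mem := fun A => s.arr (α A)

theorem State.AgreeBelow.context {α σ : ℕ → ℕ} {n b b' : ℕ} {s s' : State}
    (h : s.AgreeBelow b s') (hb : 0 < b) (hbb : b ≤ b') (hn : s.reg 0 = n) (hσ : ∀ v, σ v < b) :
    0 < b' ∧ s'.reg 0 = n ∧ (∀ v, σ v < b') ∧ s'.mem α = s.mem α ∧
      (fun v => s'.reg (σ v)) = fun v => s.reg (σ v) := by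
  refine ⟨by omega, (h.2 0 hb).trans hn, fun v => (hσ v).trans_le hbb, ?_, ?_⟩
  · unfold State.mem; rw [h.1]
  · funext v; exact h.2 _ (hσ v)

/-- The program of the term `e` computes its value within the time bound. -/
def Term.Correct (α : ℕ → ℕ) (n : ℕ) (e : Term) : Prop :=
  ∀ (σ : ℕ → ℕ) (b : ℕ) (s : State), 0 < b → s.reg 0 = n → (∀ v, σ v < b) →
    Halts (e.compile α σ b) s (e.time.eval n) fun s' =>
      s.AgreeBelow b s' ∧ s'.reg b = e.val n (s.mem α) fun v => s.reg (σ v)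

theorem Term.Correct.binary {α : ℕ → ℕ} {n : ℕ} {e f : Term} (he : e.Correct α n)
    (hf : f.Correct α n) {σ : ℕ → ℕ} {b : ℕ} {s : State} (hb : 0 < b) (hn : s.reg 0 = n)
    (hσ : ∀ v, σ v < b) {ex : Expr} {k : ℕ} (hc : ex.cost = 3)
    (hk : ∀ s' : State, s'.arr = s.arr → s'.reg b = e.val n (s.mem α) (fun v => s.reg (σ v)) →
      s'.reg (b + 1) = f.val n (s.mem α) (fun v => s.reg (σ v)) → ex.eval s' = k) :
    Halts (.seq (e.compile α σ b) (.seq (f.compile α σ (b + 1)) (.assign b ex))) s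
      ((e.time + (f.time + 4)).eval n) fun s' => s.AgreeBelow b s' ∧ s'.reg b = k := by
  refine (Halts.binary (he σ b s hb hn hσ) (T' := f.time.eval n) (fun s' hs' => ?_) hk hc).mono
    (by simp) fun _ h => h
  obtain ⟨h1, h2, h3, h4, h5⟩ := hs'.context (α := α) hb (Nat.le_succ b) hn hσ
  have := hf σ (b + 1) s' h1 h2 h3
  rwa [h4, h5] at this

/-- Structural induction in which the free registers form a stack: the value of the first operand
waits in register `b` while the second operand only uses registers from `b + 1` on. -/
theorem Term.correct (α : ℕ → ℕ) (n : ℕ) (e : Term) : e.Correct α n := by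
  induction e with
  | num c =>
    intro σ b s hb hn hσ
    refine Halts.assign (by simp [Term.time, Expr.cost])
      ⟨(State.AgreeBelow.refl _ _).setReg le_rfl _, ?_⟩
    simp [State.setReg_reg, Term.val, Expr.eval]
  | var v =>
    intro σ b s hb hn hσ
    refine Halts.assign (by simp [Term.time, Expr.cost])
      ⟨(State.AgreeBelow.refl _ _).setReg le_rfl _, ?_⟩
    simp [State.setReg_reg, Term.val, Expr.eval]
  | get A e f ihe ihf =>
    intro σ b s hb hn hσ
    refine ihe.binary ihf hb hn hσ rfl fun s' h1 h2 h3 => ?_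
    simp [Expr.eval, h1, h2, h3, Term.val, State.mem]
  | add e f ihe ihf | sub e f ihe ihf | lt e f ihe ihf | eq e f ihe ihf =>
    intro σ b s hb hn hσ
    refine ihe.binary ihf hb hn hσ rfl fun s' h1 h2 h3 => ?_
    simp [Expr.eval, h2, h3, Term.val]
  | ite c e f ihc ihe ihf =>
    intro σ b s hb hn hσ
    refine Halts.mono (T := c.time.eval n + (2 + (e.time.eval n + f.time.eval n)))
      ((ihc σ b s hb hn hσ).seq fun s' hs' => Halts.ite (fun h => ?_) fun h => ?_) ?_ fun _ h => h
    · obtain ⟨h1, h2, h3, h4, h5⟩ := hs'.1.context (α := α) hb le_rfl hn hσ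
      refine (ihe σ b s' h1 h2 h3).mono le_rfl fun s'' h'' => ⟨hs'.1.trans h''.1 le_rfl, ?_⟩
      rw [h''.2, h4, h5, Term.val, if_pos]
      rw [← hs'.2]; exact h
    · obtain ⟨h1, h2, h3, h4, h5⟩ := hs'.1.context (α := α) hb le_rfl hn hσ
      refine (ihf σ b s' h1 h2 h3).mono le_rfl fun s'' h'' => ⟨hs'.1.trans h''.1 le_rfl, ?_⟩
      rw [h''.2, h4, h5, Term.val, if_neg]
      rw [← hs'.2]; exact not_not_intro h
    · simp [Term.time]
  | sum e ih =>
    intro σ b s hb hn hσ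
    let f : ℕ → ℕ := fun i => e.val n (s.mem α) (scons i fun v => s.reg (σ v))
    -- Register `b` accumulates the sum, `b + 1` is the bound variable, and the summand is computed
    -- from `b + 2` on.
    let Inv : ℕ → State → Prop := fun i s' =>
      s.AgreeBelow b s' ∧ s'.reg (b + 1) = i ∧ s'.reg b = ∑ j ∈ Finset.range i, f j
    have hloop : ∀ s' : State, s.AgreeBelow b s' ∧ s'.reg b = 0 →
        Halts (forLoop (b + 1) (.seq (e.compile α (scons (b + 1) σ) (b + 2))
          (.assign b (.add (.reg b) (.reg (b + 2)))))) s' (n * (e.time.eval n + 4 + 8) + 6)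
          (Inv n) := by
      intro s' hs'
      refine Halts.forLoop (Inv := Inv) ⟨hs'.1.setReg (by omega) _, ?_, ?_⟩ ?_ ?_
      · simp [State.setReg_reg]
      · simp [State.setReg_reg, hs'.2]
      · intro i s₁ h₁
        exact ⟨(h₁.1.2 0 hb).trans hn, h₁.2.1⟩
      · intro i s₁ hi h₁
        obtain ⟨h2, h3, h4, h5, h6⟩ := h₁.1.context (α := α) hb (b' := b + 2) (by omega) hn hσ
        have hσ' : ∀ v, scons (b + 1) σ v < b + 2 := by
          intro v
          cases v with
          | zero => simp
          | succ v => simpa using h4 v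
        refine (ih (scons (b + 1) σ) (b + 2) s₁ h2 h3 hσ').seq fun s₂ hs₂ => ?_
        refine Halts.assign le_rfl ⟨?_, ?_, ?_⟩
        · exact ((h₁.1.trans hs₂.1 (by omega)).setReg le_rfl _).setReg (by omega) _
        · simp [State.setReg_reg, hs₂.1.2 (b + 1) (by omega), h₁.2.1]
        · have hval : s₂.reg (b + 2) = f i := by
            rw [hs₂.2, h5]
            congr 1
            funext v
            cases v with
            | zero => exact h₁.2.1
            | succ v => exact congrFun h6 v
          have hne : b ≠ b + 1 := by omega
          simp only [State.setReg_reg, if_neg hne, if_true, Expr.eval]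
          rw [Finset.sum_range_succ, hval, hs₂.1.2 b (by omega), h₁.2.2]
    have := Halts.seq (T := 2) (P := .assign b (.num 0)) (s := s)
      (Q := fun s' => s.AgreeBelow b s' ∧ s'.reg b = 0)
      (.assign le_rfl ⟨(State.AgreeBelow.refl _ _).setReg le_rfl _, by
        simp [State.setReg_reg, Expr.eval]⟩) hloop
    refine this.mono (by simp [Term.time]) fun s' hs' => ⟨hs'.1, ?_⟩
    rw [hs'.2.2, Finset.sum_range]
    rfl

/-! ### Commands -/

/-- The number of the array that stores a table: array `0` is the adjacency matrix, and array `1`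
is reserved for the output and for temporary data. -/
def arrayOf (A : ℕ) : ℕ := if A = 0 then 0 else A + 1

theorem arrayOf_ne_one (A : ℕ) : arrayOf A ≠ 1 := by unfold arrayOf; split_ifs <;> omega

theorem arrayOf_injective : Function.Injective arrayOf := by
  intro A B h; unfold arrayOf at h; split_ifs at h <;> omega

/-- Commands: `tab A e` replaces the table `A` by the table of the values of `e` (in which
the variables `0` and `1` are the row and the column), and `loop c` repeats `c` as many times as
there are vertices. -/
inductive Cmd where
  | tab (A : ℕ) (e : Term)
  | seq (c d : Cmd)
  | loop (c : Cmd)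

/-- The assignment with row `i` and column `j`. -/
def rowCol (n i j : ℕ) : ℕ → ℕ := scons i (scons j fun _ => n)

/-- Replacement of the table `A` by the table of the values of `f`. -/
def Mem.tab (n : ℕ) (M : Mem) (A : ℕ) (f : ℕ → ℕ → ℕ) : Mem :=
  Function.update M A fun i j => if i < n ∧ j < n then f i j else M A i j

/-- The effect of a command. -/
def Cmd.run (n : ℕ) : Cmd → Mem → Mem
  | tab A e, M => M.tab n A fun i j => e.val n M (rowCol n i j)
  | seq c d, M => d.run n (c.run n M)
  | loop c, M => (c.run n)^[n] M

/-- The invariant is indexed by cells in row order. By `hreg` it ignores the loop counters; by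
`hrow` a completed row is the start of the next one. -/
theorem Halts.forLoop_forLoop {b N T : ℕ} {P : Prog} {Inv : ℕ → ℕ → State → Prop} {s : State}
    (h0 : Inv 0 0 s) (hN : ∀ i j s, Inv i j s → s.reg 0 = N)
    (hreg : ∀ i j s x c, b ≤ x → Inv i j s → Inv i j (s.setReg x c))
    (hrow : ∀ i s, Inv i N s → Inv (i + 1) 0 s)
    (hP : ∀ i j s, i < N → j < N → Inv i j s → s.reg b = i → s.reg (b + 1) = j →
      Halts P s T fun s' => Inv i (j + 1) s' ∧ s'.reg b = i ∧ s'.reg (b + 1) = j) :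
    Halts (AgedLabeling.forLoop b (AgedLabeling.forLoop (b + 1) P)) s
      (N * (N * (T + 8) + 6 + 8) + 6) (Inv N 0) := by
  refine (Halts.forLoop (N := N) (Inv := fun i s => Inv i 0 s ∧ s.reg b = i) ?_ ?_ ?_).mono le_rfl
    fun s' hs' => hs'.1
  · exact ⟨hreg _ _ _ _ _ le_rfl h0, by simp [State.setReg_reg]⟩
  · exact fun i s h => ⟨hN _ _ _ h.1, h.2⟩
  · intro i s hi hs
    refine (Halts.forLoop (N := N) (T := T)
      (Inv := fun j s => Inv i j s ∧ s.reg b = i ∧ s.reg (b + 1) = j) ?_ ?_ ?_).mono le_rfl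
      fun s' hs' => ⟨hreg _ _ _ _ _ le_rfl (hrow _ _ hs'.1), by simp [State.setReg_reg, hs'.2.1]⟩
    · exact ⟨hreg _ _ _ _ _ (by omega) hs.1, by simp [State.setReg_reg, hs.2]⟩
    · exact fun j s h => ⟨hN _ _ _ h.1, h.2.2⟩
    · intro j s hj hs
      refine (hP i j s hi hj hs.1 hs.2.1 hs.2.2).mono le_rfl fun s' hs' => ⟨?_, ?_, ?_⟩
      · exact hreg _ _ _ _ _ (by omega) hs'.1
      · simp [State.setReg_reg, hs'.2.1]
      · simp [State.setReg_reg, hs'.2.2]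

/-- Rows and columns are counted in registers `b` and `b + 1`. -/
def rowColRegs (b : ℕ) : ℕ → ℕ := scons b (scons (b + 1) fun _ => 0)

theorem rowColRegs_lt (b v : ℕ) : rowColRegs b v < b + 2 := by
  unfold rowColRegs
  rcases v with _ | _ | v <;> simp [scons]

theorem rowColRegs_val {b n i j : ℕ} {s : State} (hn : s.reg 0 = n) (hi : s.reg b = i)
    (hj : s.reg (b + 1) = j) : (fun v => s.reg (rowColRegs b v)) = rowCol n i j := by
  funext v
  rcases v with _ | _ | v <;> simp [rowColRegs, rowCol, scons, hn, hi, hj]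

/-- Evaluate the term `e` for all rows and columns, and store the values in array `B`. -/
def fillProg (α : ℕ → ℕ) (B : ℕ) (e : Term) (b : ℕ) : Prog :=
  forLoop b (forLoop (b + 1) (.seq (e.compile α (rowColRegs b) (b + 2))
    (.store B (.reg b) (.reg (b + 1)) (.reg (b + 2)))))

/-- By `hB` the target array is none of those that `e` reads, so that every cell is evaluated on the
original tables, although the array is filled gradually. -/
theorem halts_fillProg {α : ℕ → ℕ} {B : ℕ} (hB : ∀ A, α A ≠ B) (e : Term) {b n : ℕ} {s : State}
    (hb : 0 < b) (hn : s.reg 0 = n) :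
    Halts (fillProg α B e b) s (n * (n * (e.time.eval n + 4 + 8) + 6 + 8) + 6) fun s' =>
      (∀ x < b, s'.reg x = s.reg x) ∧ (∀ B', B' ≠ B → s'.arr B' = s.arr B') ∧
      ∀ i j, s'.arr B i j =
        if i < n ∧ j < n then e.val n (s.mem α) (rowCol n i j) else s.arr B i j := by
  let Inv : ℕ → ℕ → State → Prop := fun i j s' =>
    (∀ x < b, s'.reg x = s.reg x) ∧ (∀ B', B' ≠ B → s'.arr B' = s.arr B') ∧
      ∀ i' j', s'.arr B i' j' = if (i' < i ∧ j' < n) ∨ (i' = i ∧ j' < j) then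
        e.val n (s.mem α) (rowCol n i' j') else s.arr B i' j'
  refine (Halts.forLoop_forLoop (Inv := Inv) (N := n) (T := e.time.eval n + 4)
    ⟨fun _ _ => rfl, fun _ _ => rfl, by simp⟩ ?_ ?_ ?_ ?_).mono le_rfl ?_
  · exact fun i j s' h => (h.1 0 hb).trans hn
  · exact fun i j s' x c hx h =>
      ⟨fun y hy => by rw [State.setReg_reg, if_neg (by omega), h.1 y hy], h.2.1, h.2.2⟩
  · refine fun i s' h => ⟨h.1, h.2.1, fun i' j' => ?_⟩
    rw [h.2.2]
    congr 1
    apply propext; omega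
  · intro i j s₁ hi hj h₁ hbi hbj
    have hn₁ := (h₁.1 0 hb).trans hn
    refine (Term.correct α n e (rowColRegs b) (b + 2) s₁ (by omega) hn₁
      (rowColRegs_lt b)).seq fun s₂ h₂ => ?_
    have hval : s₂.reg (b + 2) = e.val n (s.mem α) (rowCol n i j) := by
      rw [h₂.2, rowColRegs_val hn₁ hbi hbj]
      congr 1
      funext A
      exact h₁.2.1 _ (hB A)
    have hb0 : s₂.reg b = i := (h₂.1.2 b (by omega)).trans hbi
    have hb1 : s₂.reg (b + 1) = j := (h₂.1.2 (b + 1) (by omega)).trans hbj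
    refine Halts.store le_rfl ⟨⟨?_, ?_, ?_⟩, hb0, hb1⟩
    · intro x hx
      exact (h₂.1.2 x (by omega)).trans (h₁.1 x hx)
    · intro B' hB'
      funext k l
      rw [State.setArr_arr, if_neg (by tauto), h₂.1.1, h₁.2.1 B' hB']
    · intro i' j'
      simp only [State.setArr_arr, Expr.eval, hb0, hb1, hval, true_and]
      by_cases hij : i' = i ∧ j' = j
      · obtain ⟨rfl, rfl⟩ := hij
        simp
      · rw [if_neg hij, h₂.1.1, h₁.2.2]
        congr 1
        apply propext; omega
  · rintro s' ⟨h1, h2, h3⟩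
    refine ⟨h1, h2, fun i j => ?_⟩
    rw [h3]
    congr 1
    apply propext; omega

/-- The program of a command, using registers from `b` on. -/
def Cmd.compile : Cmd → ℕ → Prog
  -- The values go to array 1 first and are then copied, because `e` may read the very table that it
  -- replaces.
  | tab A e, b => .seq (fillProg arrayOf 1 e b)
      (fillProg (fun _ => 1) (arrayOf A) (.get 0 (.var 0) (.var 1)) b)
  | seq c d, b => .seq (c.compile b) (d.compile b)
  | loop c, b => forLoop b (c.compile (b + 1))

/-- A bound for the running time of a command. -/
noncomputable def Cmd.time : Cmd → Polynomial ℕ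
  | tab _ e => X * (X * (e.time + 4 + 8) + 6 + 8) + 6 +
      (X * (X * ((Term.get 0 (.var 0) (.var 1)).time + 4 + 8) + 6 + 8) + 6)
  | seq c d => c.time + d.time
  | loop c => X * (c.time + 8) + 6

theorem Cmd.halts_compile (n : ℕ) (c : Cmd) (b : ℕ) (s : State) (hb : 0 < b) (hn : s.reg 0 = n) :
    Halts (c.compile b) s (c.time.eval n) fun s' =>
      (∀ x < b, s'.reg x = s.reg x) ∧ s'.mem arrayOf = c.run n (s.mem arrayOf) := by
  induction c generalizing b s with
  | tab A e =>
    refine Halts.mono (T := _ + _) ((halts_fillProg arrayOf_ne_one e hb hn).seq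
      (Q' := fun s' => (∀ x < b, s'.reg x = s.reg x) ∧
        s'.mem arrayOf = (tab A e).run n (s.mem arrayOf)) fun s₁ h₁ =>
      (halts_fillProg (fun _ => (arrayOf_ne_one A).symm) _ hb ((h₁.1 0 hb).trans hn)).mono le_rfl
        fun s₂ h₂ => ⟨fun x hx => (h₂.1 x hx).trans (h₁.1 x hx), ?_⟩) ?_ fun _ h => h
    · funext B i j
      simp only [State.mem, Cmd.run, Mem.tab]
      by_cases hBA : B = A
      · subst hBA
        rw [h₂.2.2, Function.update_self]
        refine if_ctx_congr Iff.rfl (fun hij => ?_) fun _ => ?_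
        · simp only [Term.val, State.mem]
          rw [show rowCol n i j 0 = i from rfl, show rowCol n i j 1 = j from rfl, h₁.2.2,
            if_pos hij]
        · rw [h₁.2.1 _ (arrayOf_ne_one B)]
      · rw [Function.update_of_ne hBA, h₂.2.1 _ (arrayOf_injective.ne hBA),
          h₁.2.1 _ (arrayOf_ne_one B)]
        rfl
    · simp [Cmd.time]
  | seq c d ihc ihd =>
    refine Halts.mono (T := _ + _) ((ihc b s hb hn).seq
      (Q' := fun s' => (∀ x < b, s'.reg x = s.reg x) ∧
        s'.mem arrayOf = (seq c d).run n (s.mem arrayOf)) fun s₁ h₁ =>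
      (ihd b s₁ hb ((h₁.1 0 hb).trans hn)).mono le_rfl
        fun s₂ h₂ => ⟨fun x hx => (h₂.1 x hx).trans (h₁.1 x hx), ?_⟩) ?_ fun _ h => h
    · rw [h₂.2, h₁.2]
      rfl
    · simp [Cmd.time]
  | loop c ih =>
    refine (Halts.forLoop (N := n) (T := c.time.eval n) (Inv := fun i s' =>
      (∀ x < b, s'.reg x = s.reg x) ∧ s'.mem arrayOf = (c.run n)^[i] (s.mem arrayOf) ∧
        s'.reg b = i) ?_ ?_ ?_).mono (by simp [Cmd.time]) fun s' h => ⟨h.1, h.2.1⟩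
    · refine ⟨fun x hx => ?_, rfl, by simp [State.setReg_reg]⟩
      rw [State.setReg_reg, if_neg (by omega)]
    · exact fun i s' h => ⟨(h.1 0 hb).trans hn, h.2.2⟩
    · intro i s₁ hi h₁
      refine (ih (b + 1) s₁ (by omega) ((h₁.1 0 hb).trans hn)).mono le_rfl fun s₂ h₂ =>
        ⟨fun x hx => ?_, ?_, ?_⟩
      · rw [State.setReg_reg, if_neg (by omega), h₂.1 x (by omega), h₁.1 x hx]
      · rw [Function.iterate_succ_apply', ← h₁.2.1, ← h₂.2]
        rfl
      · rw [State.setReg_reg, if_pos rfl, h₂.1 b (by omega), h₁.2.2]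

/-! ### Output -/

/-- The list of triples in array `1`, as a set; its length is in register `2`. -/
def State.out (s : State) : Set (ℕ × ℕ × ℕ) :=
  {x | ∃ k < s.reg 2, s.arr 1 k 0 = x.1 ∧ s.arr 1 k 1 = x.2.1 ∧ s.arr 1 k 2 = x.2.2}

/-- A family of triples, indexed by those pairs of a row and a column for which `cond` holds. -/
structure Triples where
  cond : Term
  fst : Term
  snd : Term
  label : Term

/-- The triples of a family in row `i` and column `j`: at most one. -/
def Triples.entry (n : ℕ) (M : Mem) (E : Triples) (i j : ℕ) : Set (ℕ × ℕ × ℕ) :=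
  {x | E.cond.val n M (rowCol n i j) ≠ 0 ∧ x = (E.fst.val n M (rowCol n i j),
    E.snd.val n M (rowCol n i j), E.label.val n M (rowCol n i j))}

/-- The set of the triples of a family. -/
def Triples.toSet (n : ℕ) (M : Mem) (E : Triples) : Set (ℕ × ℕ × ℕ) :=
  {x | ∃ i < n, ∃ j < n, x ∈ E.entry n M i j}

/-- Evaluate the term `e` and write it into the current triple. -/
def Triples.field (e : Term) (k b : ℕ) : Prog :=
  .seq (e.compile arrayOf (rowColRegs b) (b + 2)) (.store 1 (.reg 2) (.num k) (.reg (b + 2)))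

/-- The program that appends a family of triples to the output. -/
def Triples.compile (E : Triples) (b : ℕ) : Prog :=
  forLoop b (forLoop (b + 1) (.seq (E.cond.compile arrayOf (rowColRegs b) (b + 2))
    (.ite (.reg (b + 2))
      (.seq (field E.fst 0 b) (.seq (field E.snd 1 b) (.seq (field E.label 2 b)
        (.assign 2 (.add (.reg 2) (.num 1))))))
      .skip)))

theorem Triples.halts_field (e : Term) (k : ℕ) {b n i j : ℕ} {s : State} (hb : 2 < b)
    (hn : s.reg 0 = n) (hi : s.reg b = i) (hj : s.reg (b + 1) = j) :
    Halts (field e k b) s (e.time.eval n + 4) fun s' =>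
      (∀ x < b + 2, s'.reg x = s.reg x) ∧ (s'.mem arrayOf = s.mem arrayOf) ∧
      ∀ c l, s'.arr 1 c l = if c = s.reg 2 ∧ l = k then
        e.val n (s.mem arrayOf) (rowCol n i j) else s.arr 1 c l := by
  refine (Term.correct arrayOf n e (rowColRegs b) (b + 2) s (by omega) hn
    (rowColRegs_lt b)).seq fun s₂ h₂ => ?_
  refine Halts.store le_rfl ⟨h₂.1.2, ?_, ?_⟩
  · funext A c l
    simp only [State.mem]
    rw [State.setArr_arr, if_neg (fun h => arrayOf_ne_one A h.1), h₂.1.1]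
  · intro c l
    rw [State.setArr_arr]
    simp only [Expr.eval, true_and]
    rw [h₂.1.1, h₂.1.2 2 (by omega), h₂.2, rowColRegs_val hn hi hj]

/-- A bound for the running time of the program of a family of triples. -/
noncomputable def Triples.time (E : Triples) : Polynomial ℕ :=
  X * (X * (E.cond.time + (2 + (E.fst.time + 4 + (E.snd.time + 4 + (E.label.time + 4 + 4)) + 1)) + 8)
    + 6 + 8) + 6

theorem Triples.halts_compile (n : ℕ) (E : Triples) (b : ℕ) (s : State) (hb : 2 < b)
    (hn : s.reg 0 = n) :
    Halts (E.compile b) s (E.time.eval n) fun s' =>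
      s'.reg 0 = n ∧ s'.mem arrayOf = s.mem arrayOf ∧
        s'.out = s.out ∪ E.toSet n (s.mem arrayOf) := by
  let M := s.mem arrayOf
  let Inv : ℕ → ℕ → State → Prop := fun i j s' =>
    s'.reg 0 = n ∧ s'.mem arrayOf = M ∧ ∀ x, x ∈ s'.out ↔
      x ∈ s.out ∨ ∃ i' j', ((i' < i ∧ j' < n) ∨ (i' = i ∧ j' < j)) ∧ x ∈ E.entry n M i' j'
  refine (Halts.forLoop_forLoop (Inv := Inv) (N := n)
    (T := E.cond.time.eval n + (2 + (E.fst.time.eval n + 4 + (E.snd.time.eval n + 4 +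
      (E.label.time.eval n + 4 + 4)) + 1))) ⟨hn, rfl, by simp⟩ ?_ ?_ ?_ ?_).mono
      (by simp [Triples.time]) ?_
  · exact fun i j s' h => h.1
  · intro i j s' x c hx h
    refine ⟨by rw [State.setReg_reg, if_neg (by omega), h.1], h.2.1, fun y => ?_⟩
    rw [← h.2.2 y]
    simp only [State.out, State.setReg_reg, if_neg (show ¬ 2 = x by omega)]
    rfl
  · refine fun i s' h => ⟨h.1, h.2.1, fun x => (h.2.2 x).trans (or_congr Iff.rfl ?_)⟩
    refine exists_congr fun i' => exists_congr fun j' => and_congr_left fun _ => ?_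
    omega
  · intro i j s₁ hi hj h₁ hbi hbj
    -- Passing from cell (i, j) to the next one adds exactly the entry of (i, j).
    have hsplit : ∀ x, (∃ i' j', ((i' < i ∧ j' < n) ∨ (i' = i ∧ j' < j + 1)) ∧
        x ∈ E.entry n M i' j') ↔ (∃ i' j', ((i' < i ∧ j' < n) ∨ (i' = i ∧ j' < j)) ∧
        x ∈ E.entry n M i' j') ∨ x ∈ E.entry n M i j := by
      intro x
      constructor
      · rintro ⟨i', j', h, hx⟩
        by_cases hij : i' = i ∧ j' = j
        · obtain ⟨rfl, rfl⟩ := hij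
          exact Or.inr hx
        · exact Or.inl ⟨i', j', by omega, hx⟩
      · rintro (⟨i', j', h, hx⟩ | hx)
        · exact ⟨i', j', by omega, hx⟩
        · exact ⟨i, j, by omega, hx⟩
    refine (Term.correct arrayOf n E.cond (rowColRegs b) (b + 2) s₁ (by omega) h₁.1
      (rowColRegs_lt b)).seq fun s₂ h₂ => ?_
    have hv := h₂.2
    rw [rowColRegs_val h₁.1 hbi hbj, h₁.2.1] at hv
    have hb0 : s₂.reg b = i := (h₂.1.2 b (by omega)).trans hbi
    have hb1 : s₂.reg (b + 1) = j := (h₂.1.2 (b + 1) (by omega)).trans hbj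
    have hn2 : s₂.reg 0 = n := (h₂.1.2 0 (by omega)).trans h₁.1
    have hm2 : s₂.mem arrayOf = M := by rw [← h₁.2.1]; unfold State.mem; rw [h₂.1.1]
    have hout2 : s₂.out = s₁.out := by
      unfold State.out
      rw [h₂.1.1, h₂.1.2 2 (by omega)]
    refine Halts.ite (fun hc => ?_) fun hc => ?_
    · refine (halts_field E.fst 0 hb hn2 hb0 hb1).seq fun s₃ h₃ => ?_
      have e3 : ∀ x < b + 2, s₃.reg x = s₂.reg x := h₃.1
      refine (halts_field E.snd 1 hb ((e3 0 (by omega)).trans hn2) ((e3 b (by omega)).trans hb0)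
        ((e3 (b + 1) (by omega)).trans hb1)).seq fun s₄ h₄ => ?_
      have e4 : ∀ x < b + 2, s₄.reg x = s₂.reg x := fun x hx => (h₄.1 x hx).trans (e3 x hx)
      refine (halts_field E.label 2 hb ((e4 0 (by omega)).trans hn2) ((e4 b (by omega)).trans hb0)
        ((e4 (b + 1) (by omega)).trans hb1)).seq fun s₅ h₅ => ?_
      have e5 : ∀ x < b + 2, s₅.reg x = s₂.reg x := fun x hx => (h₅.1 x hx).trans (e4 x hx)
      have m3 : s₃.mem arrayOf = M := h₃.2.1.trans hm2
      have m4 : s₄.mem arrayOf = M := h₄.2.1.trans m3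
      refine Halts.assign le_rfl ⟨⟨?_, h₅.2.1.trans m4, ?_⟩, ?_, ?_⟩
      · rw [State.setReg_reg, if_neg (by omega), e5 0 (by omega), hn2]
      · intro x
        rw [hsplit, ← or_assoc, ← h₁.2.2 x, ← hout2]
        have hce : x ∈ E.entry n M i j ↔ x = (E.fst.val n M (rowCol n i j),
            E.snd.val n M (rowCol n i j), E.label.val n M (rowCol n i j)) := by
          simp only [Triples.entry, Set.mem_ofPred_eq]
          exact and_iff_right (by rw [← hv]; exact hc)
        rw [hce]
        -- The three stores hit different columns of the row `reg 2`; older rows of the list are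
        -- unchanged.
        have harr : ∀ c l, s₅.arr 1 c l = if c = s₂.reg 2 ∧ l = 2 then
            E.label.val n M (rowCol n i j) else if c = s₂.reg 2 ∧ l = 1 then
            E.snd.val n M (rowCol n i j) else if c = s₂.reg 2 ∧ l = 0 then
            E.fst.val n M (rowCol n i j) else s₂.arr 1 c l := by
          intro c l
          rw [h₅.2.2, h₄.2.2, h₃.2.2, e4 2 (by omega), e3 2 (by omega), m4, m3, hm2]
        simp only [State.out, Set.mem_ofPred_eq, State.setReg_reg, if_true, Expr.eval,
          State.setReg_arr, e5 2 (show 2 < b + 2 by omega), harr]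
        constructor
        · rintro ⟨k, hk, h0, h1, h2⟩
          by_cases hk2 : k = s₂.reg 2
          · right
            subst hk2
            simp at h0 h1 h2
            rw [h0, h1, h2]
          · left
            simp [hk2] at h0 h1 h2
            exact ⟨k, by omega, h0, h1, h2⟩
        · rintro (⟨k, hk, h0, h1, h2⟩ | rfl)
          · have hk2 : k ≠ s₂.reg 2 := by omega
            exact ⟨k, by omega, by simp [hk2, h0], by simp [hk2, h1], by simp [hk2, h2]⟩
          · exact ⟨s₂.reg 2, by omega, by simp, by simp, by simp⟩
      · rw [State.setReg_reg, if_neg (by omega), e5 b (by omega), hb0]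
      · rw [State.setReg_reg, if_neg (by omega), e5 (b + 1) (by omega), hb1]
    · refine ⟨s₂, 1, .skip _, le_rfl, ⟨hn2, hm2, fun x => ?_⟩, hb0, hb1⟩
      rw [hsplit, ← or_assoc, ← h₁.2.2 x, ← hout2]
      refine (or_iff_left fun hx => hx.1 ?_).symm
      rw [← hv]; exact hc
  · rintro s' ⟨h1, h2, h3⟩
    refine ⟨h1, h2, Set.ext fun x => (h3 x).trans (or_congr Iff.rfl ?_)⟩
    simp only [Triples.toSet, Set.mem_ofPred_eq]
    constructor
    · rintro ⟨i, j, h, hx⟩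
      exact ⟨i, by omega, j, by omega, hx⟩
    · rintro ⟨i, hi, j, hj, hx⟩
      exact ⟨i, j, by omega, hx⟩

/-- The program that executes the command `c`, and outputs three families of triples. -/
def outputProg (c : Cmd) (E₁ E₂ E₃ : Triples) : Prog :=
  .seq (c.compile 3) (.seq (E₁.compile 3) (.seq (E₂.compile 3) (.seq (E₃.compile 3)
    (.assign 0 (.reg 2)))))

theorem halts_outputProg (c : Cmd) (E₁ E₂ E₃ : Triples) {n : ℕ} {s : State} (hn : s.reg 0 = n)
    (h2 : s.reg 2 = 0) :
    Halts (outputProg c E₁ E₂ E₃) s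
      ((c.time + (E₁.time + (E₂.time + (E₃.time + 2)))).eval n) fun s' =>
      s'.reg 0 = s'.reg 2 ∧ s'.out = E₁.toSet n (c.run n (s.mem arrayOf)) ∪
        E₂.toSet n (c.run n (s.mem arrayOf)) ∪ E₃.toSet n (c.run n (s.mem arrayOf)) := by
  refine Halts.mono (T := _ + (_ + (_ + (_ + 2))))
    ((c.halts_compile n 3 s (by omega) hn).seq fun s₁ h₁ => ?_) (by simp; rfl) fun _ h => h
  refine (E₁.halts_compile n 3 s₁ (by omega) ((h₁.1 0 (by omega)).trans hn)).seq fun s₂ h₂ => ?_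
  refine (E₂.halts_compile n 3 s₂ (by omega) h₂.1).seq fun s₃ h₃ => ?_
  refine (E₃.halts_compile n 3 s₃ (by omega) h₃.1).seq fun s₄ h₄ => ?_
  refine Halts.assign le_rfl ⟨by simp [State.setReg_reg, Expr.eval], ?_⟩
  have hout : (s₄.setReg 0 ((Expr.reg 2).eval s₄)).out = s₄.out := by
    unfold State.out; simp [State.setReg_reg]
  -- The table commands leave scratch data in array 1, but the list length in register 2 is still 0.
  have h0 : s₁.out = ∅ := by
    unfold State.out; rw [h₁.1 2 (by omega), h2]; simp
  rw [hout, h₄.2.2, h₃.2.2, h₂.2.2, h₃.2.1, h₂.2.1, h₁.2, h0, Set.empty_union]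
end AgedLabeling

/-! ### Temporal walks, the lower bound, and the three-phase labeling. -/

namespace AgedLabeling

/-! ### Temporal walks -/

section Temporal

variable {V : Type*} {G : SimpleGraph V}

/-- `TemporalWalk lam lo hi u v`: there is a walk from `u` to `v` with strictly increasing labels,
all of them in the interval `(lo, hi]`. -/
inductive TemporalWalk (lam : Labeling G) (hi : ℕ) : ℕ → V → V → Prop
  | nil {lo : ℕ} (u : V) : lo ≤ hi → TemporalWalk lam hi lo u u
  | cons {lo t : ℕ} {u v w : V} : t ∈ lam.at s(u, v) → lo < t → TemporalWalk lam hi t v w →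
      TemporalWalk lam hi lo u w

theorem TemporalWalk.le {lam : Labeling G} {lo hi : ℕ} {u v : V}
    (h : TemporalWalk lam hi lo u v) : lo ≤ hi := by
  induction h with
  | nil _ h => exact h
  | cons _ h _ ih => omega

theorem TemporalWalk.trans {lam : Labeling G} {lo m hi : ℕ} {u v w : V}
    (h : TemporalWalk lam m lo u v) (h' : TemporalWalk lam hi m v w) :
    TemporalWalk lam hi lo u w := by
  induction h with
  | nil u hle =>
    cases h' with
    | nil _ hle' => exact .nil _ (hle.trans hle')
    | cons ht hlt hw => exact .cons ht (by omega) hw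
  | cons ht hlt _ ih => exact .cons ht hlt (ih h')

theorem TemporalWalk.mono {lam : Labeling G} {lo lo' hi : ℕ} {u v : V}
    (h : TemporalWalk lam hi lo u v) (hlo : lo' ≤ lo) : TemporalWalk lam hi lo' u v := by
  cases h with
  | nil _ hle => exact .nil _ (hlo.trans hle)
  | cons ht hlt hw => exact .cons ht (by omega) hw

theorem TemporalWalk.trans_le {lam : Labeling G} {lo m m' hi : ℕ} {u v w : V}
    (h : TemporalWalk lam m lo u v) (hm : m ≤ m') (h' : TemporalWalk lam hi m' v w) :
    TemporalWalk lam hi lo u w :=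
  h.trans (h'.mono hm)

theorem TemporalWalk.single {lam : Labeling G} {lo t : ℕ} {u v : V} (ht : t ∈ lam.at s(u, v))
    (hlt : lo < t) : TemporalWalk lam t lo u v :=
  .cons ht hlt (.nil _ le_rfl)

theorem Labeling.mem_at {lam : Labeling G} {e : Sym2 V} {t : ℕ} :
    t ∈ lam.at e ↔ ∃ h : e ∈ G.edgeSet, t ∈ lam ⟨e, h⟩ := by
  unfold Labeling.at
  split_ifs with h
  · simp [h]
  · simp [h]

theorem TemporalWalk.exists_walk {lam : Labeling G} {lo hi : ℕ} {u v : V}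
    (h : TemporalWalk lam hi lo u v) : ∃ (p : G.Walk u v) (ts : List ℕ),
      List.Forall₂ (fun e t => t ∈ lam.at e) p.edges ts ∧ ts.Pairwise (· < ·) ∧
        ∀ t ∈ ts, lo < t := by
  induction h with
  | nil u _ => exact ⟨.nil, [], .nil, .nil, by simp⟩
  | @cons lo t u v w ht hlt _ ih =>
    obtain ⟨p, ts, h1, h2, h3⟩ := ih
    obtain ⟨he, -⟩ := Labeling.mem_at.1 ht
    have hadj : G.Adj u v := he
    refine ⟨.cons hadj p, t :: ts, ?_, ?_, ?_⟩
    · rw [SimpleGraph.Walk.edges_cons]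
      exact .cons ht h1
    · exact List.pairwise_cons.2 ⟨h3, h2⟩
    · intro x hx
      rcases List.mem_cons.1 hx with rfl | hx
      · exact hlt
      · exact hlt.trans (h3 x hx)

/-- For cutting a walk down to a path: the remaining edges keep their labels, and a sublist of an
increasing list is increasing. -/
theorem _root_.List.Forall₂.exists_sublist {α β : Type*} {R : α → β → Prop} {l l' : List α}
    {m : List β} (h : List.Forall₂ R l m) (hl : l'.Sublist l) :
    ∃ m', List.Forall₂ R l' m' ∧ m'.Sublist m := by
  induction hl generalizing m with
  | slnil => exact ⟨[], .nil, List.nil_sublist _⟩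
  | cons a _ ih =>
    cases h with
    | cons _ h2 =>
      obtain ⟨m', h3, h4⟩ := ih h2
      exact ⟨m', h3, h4.cons _⟩
  | cons_cons a _ ih =>
    cases h with
    | cons h1 h2 =>
      obtain ⟨m', h3, h4⟩ := ih h2
      exact ⟨_, .cons h1 h3, h4.cons_cons _⟩

theorem TemporalWalk.temporallyReachable {lam : Labeling G} {lo hi : ℕ} {u v : V}
    (h : TemporalWalk lam hi lo u v) : TemporallyReachable lam u v := by
  classical
  obtain ⟨p, ts, h1, h2, -⟩ := h.exists_walk
  obtain ⟨ts', h3, h4⟩ := h1.exists_sublist p.edges_bypass_sublist_edges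
  exact ⟨p.bypass, p.bypass_isPath, ts', h3, h2.sublist h4⟩

end Temporal

/-! ### A lower bound for the size of feasible labelings -/

/-- Temporal paths use labeled edges only, so these form a connected graph on V, which has at least
|V| - 1 edges, each with at least one label. -/
theorem Feasible.card_le_size_add_one {V : Type*} [Fintype V] {G : SimpleGraph V} (hG : G.Connected)
    {a : ℕ} {lam : Labeling G} (h : Feasible G a lam) : Fintype.card V ≤ lam.size + 1 := by
  classical
  let H : SimpleGraph V := SimpleGraph.fromEdgeSet {e | (lam.at e).Nonempty}
  have hH : H.Connected := by
    have := hG.nonempty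
    refine ⟨fun u v => ?_⟩
    by_cases huv : u = v
    · rw [huv]
    obtain ⟨p, -, ts, h1, -⟩ := h.2.2 u v huv
    -- Every edge of the temporal path carries the label matched to it, so the path lies in `H`.
    refine ⟨p.transfer H fun e he => ?_⟩
    have : ∃ t, t ∈ lam.at e := by
      obtain ⟨i, hi, rfl⟩ := List.mem_iff_getElem.1 he
      exact ⟨_, h1.get hi (by rw [← h1.length_eq]; exact hi)⟩
    rw [SimpleGraph.edgeSet_fromEdgeSet]
    exact ⟨this, fun hd => G.not_isDiag_of_mem_edgeSet (p.edges_subset_edgeSet he) hd⟩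
  have h1 := hH.card_vert_le_card_edgeSet_add_one
  rw [Nat.card_eq_fintype_card] at h1
  refine h1.trans (Nat.succ_le_succ ?_)
  have hsub : H.edgeSet ⊆ Subtype.val '' {e : G.edgeSet | (lam e).Nonempty} := by
    intro e he
    rw [SimpleGraph.edgeSet_fromEdgeSet] at he
    obtain ⟨t, ht⟩ := he.1
    obtain ⟨hm, ht⟩ := Labeling.mem_at.1 ht
    exact ⟨⟨e, hm⟩, ⟨t, ht⟩, rfl⟩
  have h2 : Nat.card H.edgeSet ≤ (Finset.univ.filter fun e : G.edgeSet => (lam e).Nonempty).card := by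
    rw [Nat.card_coe_set_eq]
    refine (Set.ncard_le_ncard hsub (Set.toFinite _)).trans ?_
    refine (Set.ncard_image_le (Set.toFinite _)).trans ?_
    rw [← Set.ncard_coe_finset]
    simp
  refine h2.trans ?_
  rw [Labeling.size, Finset.card_eq_sum_ones, Finset.sum_filter]
  refine Finset.sum_le_sum fun e _ => ?_
  split_ifs with he
  · exact Finset.card_pos.2 he
  · exact Nat.zero_le _

/-! ### Labelings given by families of labeled edges -/

open Classical in
/-- The labeling that gives the label `lab i` to the edge `edge i`, for all `i ∈ I`. -/
noncomputable def labelingOf {V ι : Type*} (G : SimpleGraph V) (I : Finset ι) (edge : ι → Sym2 V)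
    (lab : ι → ℕ) : Labeling G :=
  fun e => (I.filter fun i => edge i = e).image lab

section LabelingOf

variable {V ι : Type*} {G : SimpleGraph V} {I : Finset ι} {edge : ι → Sym2 V} {lab : ι → ℕ}

theorem mem_labelingOf {e : G.edgeSet} {t : ℕ} :
    t ∈ labelingOf G I edge lab e ↔ ∃ i ∈ I, edge i = e ∧ lab i = t := by
  classical
  simp [labelingOf, and_assoc]

theorem mem_labelingOf_at {i : ι} (hi : i ∈ I) (he : edge i ∈ G.edgeSet) :
    lab i ∈ (labelingOf G I edge lab).at (edge i) :=
  Labeling.mem_at.2 ⟨he, mem_labelingOf.2 ⟨i, hi, rfl, rfl⟩⟩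

/-- Only an inequality, since indices may share both edge and label. -/
theorem size_labelingOf_le [Fintype V] : (labelingOf G I edge lab).size ≤ I.card := by
  classical
  unfold Labeling.size
  calc _ ≤ ∑ e : G.edgeSet, (I.filter fun i => edge i = e).card :=
        Finset.sum_le_sum fun e _ => Finset.card_image_le
    _ = ∑ e ∈ (Finset.univ : Finset G.edgeSet).map (Function.Embedding.subtype _),
          (I.filter fun i => edge i = e).card := by
        rw [Finset.sum_map]; rfl
    _ ≤ I.card := by
        rw [Finset.sum_card_fiberwise_eq_card_filter]
        exact Finset.card_filter_le _ _

theorem lifetime_labelingOf_le [Fintype V] {a : ℕ} (h : ∀ i ∈ I, lab i ≤ a) :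
    (labelingOf G I edge lab).lifetime ≤ a := by
  classical
  unfold Labeling.lifetime
  refine Finset.sup_le fun e _ => Finset.sup_le fun t ht => ?_
  obtain ⟨i, hi, -, rfl⟩ := mem_labelingOf.1 ht
  exact h i hi

end LabelingOf

/-! ### Distance to a set of vertices -/

section SetDist

variable {V : Type*} {G : SimpleGraph V}

/-- The distance of `x` from the set `S`. -/
noncomputable def setDist (G : SimpleGraph V) (S : Finset V) (x : V) : ℕ :=
  sInf {k | ∃ s ∈ S, G.dist s x ≤ k}

theorem setDist_le_iff {S : Finset V} (hS : S.Nonempty) {x : V} {k : ℕ} :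
    setDist G S x ≤ k ↔ ∃ s ∈ S, G.dist s x ≤ k := by
  obtain ⟨s₀, hs₀⟩ := hS
  constructor
  · intro h
    obtain ⟨s, hs, hd⟩ := Nat.sInf_mem (s := {k | ∃ s ∈ S, G.dist s x ≤ k}) ⟨_, s₀, hs₀, le_rfl⟩
    exact ⟨s, hs, hd.trans h⟩
  · exact fun h => Nat.sInf_le h

theorem exists_adj_dist_add_one (hG : G.Connected) {s x : V} (h : s ≠ x) :
    ∃ w, G.Adj w x ∧ G.dist s w + 1 = G.dist s x := by
  obtain ⟨p, hp⟩ := hG.exists_walk_length_eq_dist x s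
  cases p with
  | nil => exact absurd rfl h
  | @cons _ w _ hadj q =>
    refine ⟨w, hadj.symm, ?_⟩
    have h1 := SimpleGraph.dist_le q
    have h2 := hG.dist_triangle (u := s) (v := w) (w := x)
    have h3 : G.dist w x = 1 := SimpleGraph.dist_eq_one_iff_adj.2 hadj.symm
    rw [SimpleGraph.Walk.length_cons] at hp
    rw [SimpleGraph.dist_comm] at h1 hp
    omega

theorem setDist_eq_zero (hG : G.Connected) {S : Finset V} (hS : S.Nonempty) {x : V} :
    setDist G S x = 0 ↔ x ∈ S := by
  rw [← Nat.le_zero, setDist_le_iff hS]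
  constructor
  · rintro ⟨s, hs, hd⟩
    rwa [← hG.dist_eq_zero_iff.1 (Nat.le_zero.1 hd)]
  · exact fun h => ⟨x, h, by simp⟩

theorem exists_adj_setDist_add_one (hG : G.Connected) {S : Finset V} (hS : S.Nonempty) {x : V}
    (h : 0 < setDist G S x) : ∃ w, G.Adj w x ∧ setDist G S w + 1 = setDist G S x := by
  obtain ⟨s, hs, hd⟩ := (setDist_le_iff hS).1 (le_refl (setDist G S x))
  have hd' : setDist G S x ≤ G.dist s x := (setDist_le_iff hS).2 ⟨s, hs, le_rfl⟩
  have hsx : s ≠ x := by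
    rintro rfl
    rw [SimpleGraph.dist_self] at hd'
    omega
  obtain ⟨w, hw, hdw⟩ := exists_adj_dist_add_one hG hsx
  refine ⟨w, hw, ?_⟩
  have h1 : setDist G S w ≤ G.dist s w := (setDist_le_iff hS).2 ⟨s, hs, le_rfl⟩
  obtain ⟨s', hs', hd''⟩ := (setDist_le_iff hS).1 (le_refl (setDist G S w))
  have h2 : setDist G S x ≤ G.dist s' x := (setDist_le_iff hS).2 ⟨s', hs', le_rfl⟩
  have h3 := hG.dist_triangle (u := s') (v := w) (w := x)
  have h4 : G.dist w x = 1 := SimpleGraph.dist_eq_one_iff_adj.2 hw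
  omega

end SetDist

/-! ### The labeling -/

/-- The data of the labeling: from every vertex, there is a walk to the nearest vertex of the set
`S`, from there to any vertex of `T` in a tree of shortest paths, and from `T` to all vertices. -/
structure Scheme {V : Type*} (G : SimpleGraph V) where
  S : Finset V
  T : Finset V
  r : ℕ
  nextIn : V → V
  prevOut : V → V
  parent : V → V → V
  mid : Finset (V × V)
  S_nonempty : S.Nonempty
  T_nonempty : T.Nonempty
  setDist_le : ∀ x, setDist G S x ≤ r
  nextIn_spec : ∀ x, 0 < setDist G S x →
    G.Adj (nextIn x) x ∧ setDist G S (nextIn x) + 1 = setDist G S x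
  prevOut_spec : ∀ x, 0 < setDist G T x →
    G.Adj (prevOut x) x ∧ setDist G T (prevOut x) + 1 = setDist G T x
  parent_spec : ∀ s x, s ≠ x → G.Adj (parent s x) x ∧ G.dist s (parent s x) + 1 = G.dist s x
  ne_of_mem_mid : ∀ s x, (s, x) ∈ mid → s ≠ x
  mem_mid : ∀ s ∈ S, ∀ t ∈ T, s ≠ t → (s, t) ∈ mid
  parent_mem_mid : ∀ s x, (s, x) ∈ mid → s ≠ parent s x → (s, parent s x) ∈ mid

namespace Scheme

variable {V : Type*} [Fintype V] {G : SimpleGraph V} (X : Scheme G)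

open Classical in
/-- The indices of the labels. -/
noncomputable def index : Finset (V ⊕ (V × V) ⊕ V) :=
  (Finset.univ.filter fun x => 0 < setDist G X.S x).disjSum
    (X.mid.disjSum (Finset.univ.filter fun x => 0 < setDist G X.T x))

/-- The edge of an index, as an ordered pair. -/
def pair : V ⊕ (V × V) ⊕ V → V × V
  | .inl x => (x, X.nextIn x)
  | .inr (.inl p) => (X.parent p.1 p.2, p.2)
  | .inr (.inr x) => (X.prevOut x, x)

/-- The label of an index. -/
noncomputable def label : V ⊕ (V × V) ⊕ V → ℕ
  | .inl x => X.r + 1 - setDist G X.S x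
  | .inr (.inl p) => X.r + G.dist p.1 p.2
  | .inr (.inr x) => X.r + G.diam + setDist G X.T x

/-- The labeling of a scheme. -/
noncomputable def labeling : Labeling G :=
  labelingOf G X.index (fun i => Sym2.mk (X.pair i).1 (X.pair i).2) X.label

theorem adj_pair {i : V ⊕ (V × V) ⊕ V} (hi : i ∈ X.index) : G.Adj (X.pair i).1 (X.pair i).2 := by
  classical
  rcases i with x | p | x
  · have : 0 < setDist G X.S x := by simpa [index] using hi
    exact (X.nextIn_spec x this).1.symm
  · have : p ∈ X.mid := by simpa [index] using hi
    exact (X.parent_spec _ _ (X.ne_of_mem_mid _ _ this)).1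
  · have : 0 < setDist G X.T x := by simpa [index] using hi
    exact (X.prevOut_spec x this).1

theorem label_mem_at {i : V ⊕ (V × V) ⊕ V} (hi : i ∈ X.index) :
    X.label i ∈ X.labeling.at s((X.pair i).1, (X.pair i).2) :=
  mem_labelingOf_at (edge := fun i => Sym2.mk (X.pair i).1 (X.pair i).2) hi (X.adj_pair hi)

theorem size_labeling_le : X.labeling.size ≤ 2 * Fintype.card V + X.mid.card := by
  classical
  refine size_labelingOf_le.trans ?_
  rw [index, Finset.card_disjSum, Finset.card_disjSum]
  have h1 := Finset.card_filter_le (Finset.univ : Finset V) fun x => 0 < setDist G X.S x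
  have h2 := Finset.card_filter_le (Finset.univ : Finset V) fun x => 0 < setDist G X.T x
  rw [Finset.card_univ] at h1 h2
  omega

/-- A vertex at distance d from S leaves at time r + 1 - d, and its successor is at distance d - 1,
so the labels on the way to S are consecutive and end with r. -/
theorem temporalWalk_in (hG : G.Connected) (x : V) : ∃ s ∈ X.S,
    TemporalWalk X.labeling X.r (X.r - setDist G X.S x) x s := by
  classical
  induction h : setDist G X.S x generalizing x with
  | zero => exact ⟨x, (setDist_eq_zero hG X.S_nonempty).1 h, .nil _ (Nat.sub_le _ _)⟩
  | succ k ih =>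
    obtain ⟨h1, h2⟩ := X.nextIn_spec x (by omega)
    obtain ⟨s, hs, hw⟩ := ih (X.nextIn x) (by omega)
    refine ⟨s, hs, ?_⟩
    have hi : (Sum.inl x : V ⊕ (V × V) ⊕ V) ∈ X.index := by simp [index, h]
    have hle := X.setDist_le x
    have hmem := X.label_mem_at hi
    simp only [label, pair, h] at hmem
    refine .cons hmem (by omega) ?_
    rwa [show X.r + 1 - (k + 1) = X.r - k by omega]

/-- The edge that enters x in the tree of s has label r + dist(s, x), so labels increase by one
along each tree path from its root. Labels from other trees on the same edges do no harm. -/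
theorem temporalWalk_mid {s x : V} (hx : s = x ∨ (s, x) ∈ X.mid) :
    TemporalWalk X.labeling (X.r + G.dist s x) X.r s x := by
  classical
  induction h : G.dist s x generalizing x with
  | zero =>
    rcases hx with rfl | hx
    · exact .nil _ le_rfl
    · have := X.parent_spec _ _ (X.ne_of_mem_mid _ _ hx)
      omega
  | succ k ih =>
    rcases hx with rfl | hx
    · simp at h
    · obtain ⟨h1, h2⟩ := X.parent_spec _ _ (X.ne_of_mem_mid _ _ hx)
      have hw := ih (x := X.parent s x) (by
        by_cases hs : s = X.parent s x
        · exact Or.inl hs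
        · exact Or.inr (X.parent_mem_mid _ _ hx hs)) (by omega)
      have hi : (Sum.inr (Sum.inl (s, x)) : V ⊕ (V × V) ⊕ V) ∈ X.index := by simp [index, hx]
      have hmem := X.label_mem_at hi
      simp only [label, pair, h] at hmem
      exact hw.trans (.single hmem (by omega))

theorem temporalWalk_out (hG : G.Connected) (x : V) : ∃ t ∈ X.T,
    TemporalWalk X.labeling (X.r + G.diam + setDist G X.T x) (X.r + G.diam) t x := by
  classical
  induction h : setDist G X.T x generalizing x with
  | zero => exact ⟨x, (setDist_eq_zero hG X.T_nonempty).1 h, .nil _ le_rfl⟩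
  | succ k ih =>
    obtain ⟨h1, h2⟩ := X.prevOut_spec x (by omega)
    obtain ⟨t, ht, hw⟩ := ih (X.prevOut x) (by omega)
    refine ⟨t, ht, hw.trans (.single ?_ (by omega))⟩
    have hi : (Sum.inr (Sum.inr x) : V ⊕ (V × V) ⊕ V) ∈ X.index := by simp [index, h]
    have hmem := X.label_mem_at hi
    simpa only [label, pair, h] using hmem

theorem feasible_labeling (hG : G.Connected) {a : ℕ}
    (ha : ∀ x, X.r + G.diam + setDist G X.T x ≤ a) : Feasible G a X.labeling := by
  classical
  have hdiam : ∀ u v, G.dist u v ≤ G.diam := fun u v => by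
    have := hG.nonempty
    exact SimpleGraph.dist_le_diam (SimpleGraph.connected_iff_ediam_ne_top.1 hG)
  refine ⟨?_, lifetime_labelingOf_le ?_, fun u w _ => ?_⟩
  · intro e t ht
    obtain ⟨i, hi, -, rfl⟩ := mem_labelingOf.1 ht
    rcases i with x | p | x
    · have := X.setDist_le x
      simp only [label]; omega
    · have : p ∈ X.mid := by simpa [index] using hi
      have := hG.pos_dist_of_ne (X.ne_of_mem_mid p.1 p.2 this)
      simp only [label]; omega
    · have : 0 < setDist G X.T x := by simpa [index] using hi
      simp only [label]; omega
  · intro i hi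
    rcases i with x | p | x
    · have : 0 < setDist G X.S x := by simpa [index] using hi
      have := ha x
      simp only [label]; omega
    · have := hdiam p.1 p.2
      have := ha p.1
      simp only [label]; omega
    · exact ha x
  · obtain ⟨s, hs, h1⟩ := X.temporalWalk_in hG u
    obtain ⟨t, ht, h3⟩ := X.temporalWalk_out hG w
    have h2 := X.temporalWalk_mid (s := s) (x := t)
      (or_iff_not_imp_left.2 fun h => X.mem_mid s hs t ht h)
    -- The middle walk may arrive at t before time r + D; `trans_le` waits there for the last phase.
    exact ((h1.trans h2).trans_le (by have := hdiam s t; omega) h3).temporallyReachable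

end Scheme
end AgedLabeling

/-! ### Counting: middle labels, the greedy covering set, and the numerical bounds. -/

namespace AgedLabeling

/-! ### The set of the middle labels -/

/-- Each step towards the root lowers the distance by one. The root is its own parent, which agrees
with the truncated subtraction. -/
theorem dist_iterate_parent {V : Type*} {G : SimpleGraph V} {parent : V → V → V}
    (hself : ∀ s, parent s s = s)
    (hpar : ∀ s x, s ≠ x → G.Adj (parent s x) x ∧ G.dist s (parent s x) + 1 = G.dist s x)
    (s t : V) (j : ℕ) : G.dist s ((parent s)^[j] t) = G.dist s t - j := by
  induction j with
  | zero => rfl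
  | succ j ih =>
    rw [Function.iterate_succ_apply']
    by_cases h : s = (parent s)^[j] t
    · rw [← h, SimpleGraph.dist_self] at ih
      rw [← h, hself, SimpleGraph.dist_self]
      omega
    · have := (hpar _ _ h).2
      omega

section Mid

variable {V : Type*} [Fintype V] {G : SimpleGraph V} {parent : V → V → V}

theorem dist_lt_card (hG : G.Connected) (u v : V) : G.dist u v < Fintype.card V := by
  obtain ⟨p, hp, hl⟩ := hG.exists_path_of_dist u v
  rw [← hl]
  exact hp.length_lt

theorem diam_lt_card (hG : G.Connected) : G.diam < Fintype.card V := by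
  have := hG.nonempty
  obtain ⟨u, v, h⟩ := G.exists_dist_eq_diam
  rw [← h]
  exact dist_lt_card hG u v

theorem dist_le_diam_of_connected (hG : G.Connected) (u v : V) : G.dist u v ≤ G.diam := by
  have := hG.nonempty
  exact SimpleGraph.dist_le_diam (SimpleGraph.connected_iff_ediam_ne_top.1 hG)

open Classical in
/-- The pairs `(s, x)` such that `s ∈ S` and `x ≠ s` lies on the path from `s` to a vertex of `T` in
the tree of shortest paths that is given by `parent s`. -/
noncomputable def midSet (S T : Finset V) (parent : V → V → V) : Finset (V × V) :=
  Finset.univ.filter fun p => p.1 ∈ S ∧ p.1 ≠ p.2 ∧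
    ∃ t ∈ T, ∃ j < Fintype.card V, (parent p.1)^[j] t = p.2

theorem mem_midSet {S T : Finset V} {s x : V} : (s, x) ∈ midSet S T parent ↔
    s ∈ S ∧ s ≠ x ∧ ∃ t ∈ T, ∃ j < Fintype.card V, (parent s)^[j] t = x := by
  simp [midSet]

theorem card_midSet_le_mul_card (S T : Finset V) :
    (midSet S T parent).card ≤ S.card * Fintype.card V := by
  rw [← Finset.card_univ, ← Finset.card_product]
  refine Finset.card_le_card fun p hp => ?_
  exact Finset.mem_product.2 ⟨(mem_midSet.1 hp).1, Finset.mem_univ _⟩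

/-- A pair (s, x) is determined by s, the endpoint t and the number j of steps from t back to x; as
x ≠ s, the path is not exhausted, so j < dist(s, t) ≤ D. -/
theorem card_midSet_le_mul_diam (hG : G.Connected) (hself : ∀ s, parent s s = s)
    (hpar : ∀ s x, s ≠ x → G.Adj (parent s x) x ∧ G.dist s (parent s x) + 1 = G.dist s x)
    (S T : Finset V) : (midSet S T parent).card ≤ S.card * (T.card * G.diam) := by
  classical
  rw [← Finset.card_range G.diam, ← Finset.card_product, ← Finset.card_product]
  refine (Finset.card_le_card fun p hp => ?_).trans
    (Finset.card_image_le (f := fun q : V × V × ℕ => (q.1, (parent q.1)^[q.2.2] q.2.1)))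
  obtain ⟨s, x⟩ := p
  obtain ⟨hs, hne, t, ht, j, -, hj⟩ := mem_midSet.1 hp
  refine Finset.mem_image.2 ⟨(s, t, j), ?_, by rw [hj]⟩
  have h1 := dist_iterate_parent hself hpar s t j
  rw [hj] at h1
  have h2 := hG.pos_dist_of_ne hne
  have h3 := dist_le_diam_of_connected hG s t
  simp only [Finset.mem_product, Finset.mem_range]
  exact ⟨hs, ht, by omega⟩

/-- The scheme given by two sets of vertices and by parent functions. -/
noncomputable def Scheme.ofParent (hG : G.Connected) (S T : Finset V) (r : ℕ) (nextIn prevOut : V → V)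
    (parent : V → V → V) (hS : S.Nonempty) (hT : T.Nonempty) (hr : ∀ x, setDist G S x ≤ r)
    (hin : ∀ x, 0 < setDist G S x →
      G.Adj (nextIn x) x ∧ setDist G S (nextIn x) + 1 = setDist G S x)
    (hout : ∀ x, 0 < setDist G T x →
      G.Adj (prevOut x) x ∧ setDist G T (prevOut x) + 1 = setDist G T x)
    (hself : ∀ s, parent s s = s)
    (hpar : ∀ s x, s ≠ x → G.Adj (parent s x) x ∧ G.dist s (parent s x) + 1 = G.dist s x) :
    Scheme G where
  S := S
  T := T
  r := r
  nextIn := nextIn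
  prevOut := prevOut
  parent := parent
  mid := midSet S T parent
  S_nonempty := hS
  T_nonempty := hT
  setDist_le := hr
  nextIn_spec := hin
  prevOut_spec := hout
  parent_spec := hpar
  ne_of_mem_mid := fun s x h => (mem_midSet.1 h).2.1
  mem_mid := fun s hs t ht hst => mem_midSet.2 ⟨hs, hst, t, ht, 0, by
    have := dist_lt_card hG s t; omega, rfl⟩
  parent_mem_mid := fun s x h hne => by
    obtain ⟨hs, hsx, t, ht, j, hj, hx⟩ := mem_midSet.1 h
    -- The parent is still different from s, hence j + 1 < dist(s, t), which is less than the number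
    -- of vertices.
    refine mem_midSet.2 ⟨hs, hne, t, ht, j + 1, ?_, ?_⟩
    · have h1 := dist_iterate_parent hself hpar s t j
      have h2 := hG.pos_dist_of_ne hsx
      have h3 := (hpar _ _ hsx).2
      have h4 := hG.pos_dist_of_ne hne
      have h5 := dist_lt_card hG s t
      rw [hx] at h1
      omega
    · rw [Function.iterate_succ_apply', hx]

end Mid

/-! ### Greedy dominating sets -/

section Greedy

variable {V : Type*} [Fintype V] {G : SimpleGraph V} {ρ : ℕ}

open Classical in
/-- The ball of radius `ρ` around `v`. -/
noncomputable def ballSet (G : SimpleGraph V) (ρ : ℕ) (v : V) : Finset V :=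
  Finset.univ.filter fun x => G.dist v x ≤ ρ

open Classical in
/-- The vertices at distance more than `ρ` from `S`. -/
noncomputable def uncovered (G : SimpleGraph V) (ρ : ℕ) (S : Finset V) : Finset V :=
  Finset.univ.filter fun x => ∀ s ∈ S, ¬ G.dist s x ≤ ρ

open Classical in
/-- The number of vertices outside the balls around `S` that the ball around `v` contains. -/
noncomputable def gain (G : SimpleGraph V) (ρ : ℕ) (S : Finset V) (v : V) : ℕ :=
  ((uncovered G ρ S).filter fun x => G.dist v x ≤ ρ).card

theorem mem_ballSet {v x : V} : x ∈ ballSet G ρ v ↔ G.dist v x ≤ ρ := by simp [ballSet]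

theorem mem_uncovered {S : Finset V} {x : V} :
    x ∈ uncovered G ρ S ↔ ∀ s ∈ S, ¬ G.dist s x ≤ ρ := by simp [uncovered]

/-- One step of the greedy algorithm, from `S` to `S'`. -/
def GreedyStep [DecidableEq V] (G : SimpleGraph V) (ρ : ℕ) (S S' : Finset V) : Prop :=
  (uncovered G ρ S = ∅ → S' = S) ∧
    ((uncovered G ρ S).Nonempty → ∃ v, S' = insert v S ∧ ∀ w, gain G ρ S w ≤ gain G ρ S v)

theorem card_uncovered_insert [DecidableEq V] (S : Finset V) (v : V) :
    (uncovered G ρ (insert v S)).card + gain G ρ S v = (uncovered G ρ S).card := by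
  classical
  rw [gain, ← Finset.card_filter_add_card_filter_not (s := uncovered G ρ S)
    (fun x => G.dist v x ≤ ρ), add_comm]
  congr 2
  ext x
  simp only [mem_uncovered, Finset.mem_filter, Finset.mem_insert, forall_eq_or_imp]
  tauto

/-- Double counting: by symmetry of the distance each uncovered vertex lies in at least k balls, so
the gains sum to at least k times the number of uncovered vertices, and the best gain is at least
the average. -/
theorem mul_card_uncovered_le {k : ℕ} (hk : ∀ v, k ≤ (ballSet G ρ v).card) {S : Finset V} {v : V}
    (hv : ∀ w, gain G ρ S w ≤ gain G ρ S v) :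
    k * (uncovered G ρ S).card ≤ Fintype.card V * gain G ρ S v := by
  classical
  calc k * (uncovered G ρ S).card = ∑ _x ∈ uncovered G ρ S, k := by
        rw [Finset.sum_const, smul_eq_mul, mul_comm]
    _ ≤ ∑ x ∈ uncovered G ρ S, ((Finset.univ : Finset V).filter fun w => G.dist w x ≤ ρ).card := by
        refine Finset.sum_le_sum fun x _ => (hk x).trans (le_of_eq ?_)
        congr 1
        ext w
        simp [mem_ballSet, SimpleGraph.dist_comm]
    _ = ∑ w : V, gain G ρ S w := by
        simp only [gain]
        exact (Finset.sum_card_bipartiteAbove_eq_sum_card_bipartiteBelow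
          (fun w x => G.dist w x ≤ ρ)).symm
    _ ≤ ∑ _w : V, gain G ρ S v := Finset.sum_le_sum fun w _ => hv w
    _ = Fintype.card V * gain G ρ S v := by
        rw [Finset.sum_const, smul_eq_mul, Finset.card_univ]

variable [DecidableEq V] {A : ℕ → Finset V}

theorem card_greedy_le (hA0 : A 0 = ∅) (hA : ∀ i, GreedyStep G ρ (A i) (A (i + 1))) (i : ℕ) :
    (A i).card ≤ i := by
  classical
  induction i with
  | zero => simp [hA0]
  | succ i ih =>
    rcases (uncovered G ρ (A i)).eq_empty_or_nonempty with h | h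
    · rw [(hA i).1 h]; omega
    · obtain ⟨v, hv, -⟩ := (hA i).2 h
      rw [hv]
      exact (Finset.card_insert_le _ _).trans (by convert Nat.succ_le_succ ih)

theorem greedy_stable (hA : ∀ i, GreedyStep G ρ (A i) (A (i + 1))) {i : ℕ}
    (h : uncovered G ρ (A i) = ∅) (j : ℕ) : A (i + j) = A i := by
  induction j with
  | zero => rfl
  | succ j ih => rw [← add_assoc, (hA (i + j)).1 (by rw [ih, h]), ih]

/-- The linear bound holds because each round covers a new vertex while any is left; it shows that n
rounds cover everything. The geometric bound follows from the averaging lemma and controls the size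
of the set. -/
theorem card_uncovered_greedy_le {k : ℕ} (hk : ∀ v, k ≤ (ballSet G ρ v).card) (hk0 : 0 < k)
    (hA : ∀ i, GreedyStep G ρ (A i) (A (i + 1))) (i : ℕ) :
    (uncovered G ρ (A i)).card ≤ Fintype.card V - i ∧
    ((uncovered G ρ (A i)).card : ℝ) ≤
      Fintype.card V * (1 - (k : ℝ) / Fintype.card V) ^ i := by
  classical
  induction i with
  | zero =>
    have := Finset.card_le_univ (uncovered G ρ (A 0))
    simpa using this
  | succ i ih =>
    rcases (uncovered G ρ (A i)).eq_empty_or_nonempty with h | h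
    · rw [(hA i).1 h, h]
      refine ⟨by simp, ?_⟩
      rcases isEmpty_or_nonempty V with hV | ⟨⟨v⟩⟩
      · simp
      · have h1 : (k : ℝ) ≤ Fintype.card V := by
          exact_mod_cast (hk v).trans (Finset.card_le_univ _)
        have h2 : (k : ℝ) / Fintype.card V ≤ 1 := div_le_one_of_le₀ h1 (by positivity)
        have h3 : 0 ≤ 1 - (k : ℝ) / Fintype.card V := by linarith
        simp only [Finset.card_empty, Nat.cast_zero]
        positivity
    · obtain ⟨v, hv, hmax⟩ := (hA i).2 h
      have h1 := card_uncovered_insert (G := G) (ρ := ρ) (A i) v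
      have h2 := mul_card_uncovered_le hk hmax
      have hc := h.card_pos
      have hn : 0 < Fintype.card V := Fintype.card_pos_iff.2 ⟨v⟩
      have hg : 0 < gain G ρ (A i) v := by
        by_contra hg
        have : gain G ρ (A i) v = 0 := by omega
        rw [this] at h2
        have := Nat.mul_pos hk0 hc
        omega
      have hv' : A (i + 1) = insert v (A i) := by rw [hv]
      rw [hv']
      refine ⟨by omega, ?_⟩
      have h1' : ((uncovered G ρ (insert v (A i))).card : ℝ) + gain G ρ (A i) v =
        (uncovered G ρ (A i)).card := by exact_mod_cast h1
      have h2' : (k : ℝ) * (uncovered G ρ (A i)).card ≤ Fintype.card V * gain G ρ (A i) v := by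
        exact_mod_cast h2
      have hn' : (0 : ℝ) < Fintype.card V := by exact_mod_cast hn
      have h3 : (k : ℝ) / Fintype.card V * (uncovered G ρ (A i)).card ≤ gain G ρ (A i) v := by
        rw [div_mul_eq_mul_div, div_le_iff₀ hn']
        linarith
      have hkn : (k : ℝ) ≤ Fintype.card V := by
        exact_mod_cast (hk v).trans (Finset.card_le_univ _)
      have h4 : 0 ≤ 1 - (k : ℝ) / Fintype.card V := by
        have : (k : ℝ) / Fintype.card V ≤ 1 := div_le_one_of_le₀ hkn hn'.le
        linarith
      calc ((uncovered G ρ (insert v (A i))).card : ℝ)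
          ≤ (uncovered G ρ (A i)).card * (1 - (k : ℝ) / Fintype.card V) := by linarith
        _ ≤ (Fintype.card V * (1 - (k : ℝ) / Fintype.card V) ^ i) *
            (1 - (k : ℝ) / Fintype.card V) := mul_le_mul_of_nonneg_right ih.2 h4
        _ = _ := by ring

theorem uncovered_greedy_card {k : ℕ} (hk : ∀ v, k ≤ (ballSet G ρ v).card) (hk0 : 0 < k)
    (hA : ∀ i, GreedyStep G ρ (A i) (A (i + 1))) :
    uncovered G ρ (A (Fintype.card V)) = ∅ := by
  have := (card_uncovered_greedy_le hk hk0 hA (Fintype.card V)).1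
  rw [← Finset.card_eq_zero]
  omega

/-- After more than n log n / k rounds fewer than n e^(-log n) = 1 vertices are uncovered. The set
then stays constant, so the remaining ones of the n rounds do not enlarge it. -/
theorem card_greedy_card_le {k : ℕ} (hk : ∀ v, k ≤ (ballSet G ρ v).card) (hk0 : 0 < k)
    (hA0 : A 0 = ∅) (hA : ∀ i, GreedyStep G ρ (A i) (A (i + 1))) (hV : Nonempty V) :
    ((A (Fintype.card V)).card : ℝ) ≤
      Fintype.card V * Real.log (Fintype.card V) / k + 1 := by
  obtain ⟨v⟩ := hV
  have hn' : (0 : ℝ) < Fintype.card V := by exact_mod_cast Fintype.card_pos_iff.2 ⟨v⟩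
  have hk' : (0 : ℝ) < k := by exact_mod_cast hk0
  set n : ℝ := (Fintype.card V : ℝ) with hn
  have hlog : 0 ≤ Real.log n := Real.log_natCast_nonneg _
  -- The floor plus one makes m strictly larger than n log n / k, which gives the strict bound `h7`.
  set m := ⌊n * Real.log n / k⌋₊ + 1 with hm
  have hm1 : n * Real.log n / k < m := by
    rw [hm]; push_cast; exact Nat.lt_floor_add_one _
  have hm2 : (m : ℝ) ≤ n * Real.log n / k + 1 := by
    rw [hm]; push_cast
    have := Nat.floor_le (show 0 ≤ n * Real.log n / k by positivity)
    linarith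
  suffices h : (A (Fintype.card V)).card ≤ m from (Nat.cast_le.2 h).trans hm2
  rcases le_total (Fintype.card V) m with hle | hle
  · exact (card_greedy_le hA0 hA _).trans hle
  · have hunc : uncovered G ρ (A m) = ∅ := by
      have h1 := (card_uncovered_greedy_le hk hk0 hA m).2
      have hkn : (k : ℝ) ≤ n := by
        rw [hn]
        exact_mod_cast (hk v).trans (Finset.card_le_univ _)
      have h4 : 0 ≤ 1 - (k : ℝ) / n := by
        have : (k : ℝ) / n ≤ 1 := div_le_one_of_le₀ hkn hn'.le
        linarith
      have h5 : (1 - (k : ℝ) / n) ^ m ≤ Real.exp (-(k / n * m)) := by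
        calc (1 - (k : ℝ) / n) ^ m ≤ Real.exp (-(k / n)) ^ m :=
              pow_le_pow_left₀ h4 (by have := Real.add_one_le_exp (-((k : ℝ) / n)); linarith) m
          _ = _ := by rw [← Real.exp_nat_mul]; congr 1; ring
      have h6 : Real.log n < k / n * m := by
        rw [div_lt_iff₀ hk'] at hm1
        rw [div_mul_eq_mul_div, lt_div_iff₀ hn']
        linarith
      have h7 : n * (1 - (k : ℝ) / n) ^ m < 1 := by
        calc n * (1 - (k : ℝ) / n) ^ m ≤ n * Real.exp (-(k / n * m)) :=
              mul_le_mul_of_nonneg_left h5 hn'.le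
          _ < n * Real.exp (-Real.log n) :=
              mul_lt_mul_of_pos_left (Real.exp_lt_exp.2 (by linarith)) hn'
          _ = 1 := by rw [Real.exp_neg, Real.exp_log hn', mul_inv_cancel₀ hn'.ne']
      rw [← Finset.card_eq_zero]
      have : ((uncovered G ρ (A m)).card : ℝ) < 1 := h1.trans_lt h7
      have : (uncovered G ρ (A m)).card < 1 := by exact_mod_cast this
      omega
    obtain ⟨j, hj⟩ := Nat.exists_eq_add_of_le hle
    rw [hj, greedy_stable hA hunc]
    exact card_greedy_le hA0 hA m

end Greedy

/-! ### Numerical bounds -/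

theorem one_le_mul_log {n : ℝ} (hn : 2 ≤ n) : 1 ≤ n * Real.log n := by
  have h1 : Real.log 2 ≤ Real.log n := Real.log_le_log (by norm_num) hn
  have h2 := Real.log_two_gt_d9
  nlinarith

/-- Either k or n log n / k is at most √(n log n); the summand 1 is absorbed because the root is at
least 1. -/
theorem min_le_two_mul_sqrt {n k g : ℝ} (hn : 2 ≤ n) (hk : 0 < k) (hg : g ≤ n * Real.log n / k + 1) :
    min k g ≤ 2 * √(n * Real.log n) := by
  have h1 := one_le_mul_log hn
  have hs : 1 ≤ √(n * Real.log n) := Real.one_le_sqrt.2 h1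
  have hsq := Real.mul_self_sqrt (show 0 ≤ n * Real.log n by linarith)
  rcases le_total k √(n * Real.log n) with h | h
  · exact (min_le_left _ _).trans (by linarith)
  · refine (min_le_right _ _).trans (hg.trans ?_)
    have : n * Real.log n / k ≤ √(n * Real.log n) := by
      rw [div_le_iff₀ hk]
      nlinarith
    linarith

/-- The threshold K = (D n log² n)^(1/3) balances the two costs: (n log n / K)² D = n K. If k ≤ K
the first cost is at most n K, otherwise the second is at most 2 n K + 2 D. As 2 n ≤ 4 n K and D ≤
n, everything is at most 10 n K. -/
theorem min_le_mul_cbrt {n k g D : ℝ} (hn : 2 ≤ n) (hk : 0 < k) (hg0 : 0 ≤ g)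
    (hg : g ≤ n * Real.log n / k + 1) (hD : 1 ≤ D) (hDn : D ≤ n) :
    2 * n + min (n * k) (g * g * D) ≤ 10 * n * (D * n * Real.log n ^ 2) ^ (1 / 3 : ℝ) := by
  have hl : 1 / 2 ≤ Real.log n := by
    have h1 : Real.log 2 ≤ Real.log n := Real.log_le_log (by norm_num) hn
    have h2 := Real.log_two_gt_d9
    linarith
  set l := Real.log n
  have hpos : 0 ≤ D * n * l ^ 2 := by positivity
  set K := (D * n * l ^ 2) ^ (1 / 3 : ℝ) with hK
  have hK3 : K ^ 3 = D * n * l ^ 2 := by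
    rw [hK, ← Real.rpow_natCast, ← Real.rpow_mul hpos]
    norm_num
  have hK0 : 0 ≤ K := Real.rpow_nonneg hpos _
  have hKh : 1 / 2 ≤ K := by
    by_contra h
    push Not at h
    have h1 : K ^ 3 < (1 / 2) ^ 3 := pow_lt_pow_left₀ h hK0 (by norm_num)
    have h2 : (1 / 2) ^ 2 ≤ l ^ 2 := pow_le_pow_left₀ (by norm_num) hl 2
    have h3 : 1 * 2 ≤ D * n := mul_le_mul hD hn (by norm_num) (by linarith)
    have h4 : 1 * 2 * (1 / 2) ^ 2 ≤ D * n * l ^ 2 :=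
      mul_le_mul h3 h2 (by norm_num) (by positivity)
    rw [hK3] at h1
    norm_num at h1 h4
    linarith
  have hnK : n ≤ 2 * (n * K) := by nlinarith
  rcases le_total k K with h | h
  · have : n * k ≤ n * K := mul_le_mul_of_nonneg_left h (by linarith)
    have := min_le_left (n * k) (g * g * D)
    nlinarith
  · have hq0 : 0 ≤ n * l / k := by positivity
    have hKpos : 0 < K := by linarith
    have hq : n * l / k ≤ n * l / K := div_le_div_of_nonneg_left (by positivity) hKpos h
    have hg2 : g * g ≤ 2 * (n * l / K) ^ 2 + 2 := by
      have h1 : g * g ≤ (n * l / K + 1) * (n * l / K + 1) :=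
        mul_self_le_mul_self hg0 (by linarith)
      nlinarith [sq_nonneg (n * l / K - 1)]
    have hK2 : (n * l / K) ^ 2 * D = n * K := by
      field_simp
      linarith [hK3]
    have h2 : g * g * D ≤ 2 * (n * K) + 2 * D := by
      calc g * g * D ≤ (2 * (n * l / K) ^ 2 + 2) * D :=
            mul_le_mul_of_nonneg_right hg2 (by linarith)
        _ = 2 * ((n * l / K) ^ 2 * D) + 2 * D := by ring
        _ = _ := by rw [hK2]
    have := min_le_right (n * k) (g * g * D)
    linarith
end AgedLabeling

/-! ### Derived terms, and the computation of distances. -/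

namespace AgedLabeling

/-! ### Derived terms -/

namespace Term

/-- Negation. -/
def not (e : Term) : Term := .eq e (.num 0)

/-- Conjunction. -/
def and (e f : Term) : Term := .ite e f (.num 0)

/-- Disjunction. -/
def or (e f : Term) : Term := .ite e (.num 1) f

/-- Comparison. -/
def le (e f : Term) : Term := not (.lt f e)

/-- Existential quantification over the vertices. -/
def ex (e : Term) : Term := .lt (.num 0) (.sum e)

/-- The number of vertices with a property. -/
def count (e : Term) : Term := .sum (.ite e (.num 1) (.num 0))

/-- The least vertex with the property `e` of the variable `0`. The variable `1` is reserved. -/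
def first (e : Term) : Term := count (not (ex (and (le (.var 0) (.var 1)) e)))

/-- The sum of `q` copies of `e`. -/
def nsmul : ℕ → Term → Term
  | 0, _ => .num 0
  | q + 1, e => .add e (nsmul q e)

variable {n : ℕ} {M : Mem} {ρ : ℕ → ℕ} {e f : Term}

@[simp] theorem val_num (c : ℕ) : (num c).val n M ρ = c := rfl

@[simp] theorem val_var (v : ℕ) : (var v).val n M ρ = ρ v := rfl

@[simp] theorem val_get (A : ℕ) : (get A e f).val n M ρ = M A (e.val n M ρ) (f.val n M ρ) := rfl

@[simp] theorem val_add : (add e f).val n M ρ = e.val n M ρ + f.val n M ρ := rfl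

@[simp] theorem val_sub : (sub e f).val n M ρ = e.val n M ρ - f.val n M ρ := rfl

@[simp] theorem val_ite {c : Term} :
    (ite c e f).val n M ρ = if c.val n M ρ ≠ 0 then e.val n M ρ else f.val n M ρ := rfl

@[simp] theorem val_sum : (sum e).val n M ρ = ∑ i : Fin n, e.val n M (scons i ρ) := rfl

@[simp] theorem val_lt_ne_zero : (lt e f).val n M ρ ≠ 0 ↔ e.val n M ρ < f.val n M ρ := by
  simp [val]

@[simp] theorem val_eq_ne_zero : (eq e f).val n M ρ ≠ 0 ↔ e.val n M ρ = f.val n M ρ := by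
  simp [val]

@[simp] theorem val_not_ne_zero : (not e).val n M ρ ≠ 0 ↔ ¬ e.val n M ρ ≠ 0 := by
  rw [not, val_eq_ne_zero, val_num, not_not]

@[simp] theorem val_and_ne_zero :
    (and e f).val n M ρ ≠ 0 ↔ e.val n M ρ ≠ 0 ∧ f.val n M ρ ≠ 0 := by
  simp [and, val]

@[simp] theorem val_or_ne_zero :
    (or e f).val n M ρ ≠ 0 ↔ e.val n M ρ ≠ 0 ∨ f.val n M ρ ≠ 0 := by
  by_cases h : e.val n M ρ = 0 <;> simp [or, val, h]

@[simp] theorem val_le_ne_zero : (le e f).val n M ρ ≠ 0 ↔ e.val n M ρ ≤ f.val n M ρ := by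
  rw [le, val_not_ne_zero, val_lt_ne_zero, not_lt]

@[simp] theorem val_ex_ne_zero :
    (ex e).val n M ρ ≠ 0 ↔ ∃ i : Fin n, e.val n M (scons i ρ) ≠ 0 := by
  rw [ex, val_lt_ne_zero, val_num, val_sum, Nat.pos_iff_ne_zero, Ne, Finset.sum_eq_zero_iff]
  simp

@[simp] theorem val_nsmul (q : ℕ) : (nsmul q e).val n M ρ = q * e.val n M ρ := by
  induction q with
  | zero => simp [nsmul]
  | succ q ih => simp [nsmul, ih, Nat.succ_mul, add_comm]

theorem val_count (P : Fin n → Prop) [DecidablePred P]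
    (h : ∀ i : Fin n, e.val n M (scons i ρ) ≠ 0 ↔ P i) :
    (count e).val n M ρ = (Finset.univ.filter P).card := by
  simp [count, h, Finset.sum_boole]

theorem val_count_eq {m : ℕ} (hm : m ≤ n)
    (h : ∀ i : Fin n, e.val n M (scons i ρ) ≠ 0 ↔ (i : ℕ) < m) : (count e).val n M ρ = m := by
  rw [val_count _ h, Fin.card_filter_val_lt, min_eq_right hm]

/-- The vertices v with no witness w ≤ v are exactly those below the least witness, so counting them
yields its number. The term must not depend on v, and free variables of the context are shifted by
two. -/
theorem val_first {P : Fin n → Prop}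
    (h : ∀ w v : Fin n, e.val n M (scons w (scons v ρ)) ≠ 0 ↔ P w) (hP : ∃ w, P w) :
    ∃ w : Fin n, (first e).val n M ρ = w ∧ P w := by
  classical
  have hex : ∃ k, ∃ hk : k < n, P ⟨k, hk⟩ := ⟨_, hP.choose.2, hP.choose_spec⟩
  obtain ⟨hlt, hw⟩ := Nat.find_spec hex
  refine ⟨⟨Nat.find hex, hlt⟩, val_count_eq hlt.le fun v => ?_, hw⟩
  simp only [val_not_ne_zero, val_ex_ne_zero, val_and_ne_zero, val_le_ne_zero, h, val_var,
    scons_zero, scons_one]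
  constructor
  · intro hv
    by_contra hle
    exact hv ⟨⟨_, hlt⟩, not_lt.1 hle, hw⟩
  · rintro hlt' ⟨w, hle, hPw⟩
    have := Nat.find_min' hex ⟨w.2, hPw⟩
    omega

end Term

open Term

/-! ### Reading tables -/

@[simp] theorem rowCol_zero (n i j : ℕ) : rowCol n i j 0 = i := rfl

@[simp] theorem rowCol_one (n i j : ℕ) : rowCol n i j 1 = j := rfl

/-- The first table that a command changes. -/
def Cmd.lo : Cmd → ℕ
  | tab A _ => A
  | seq c d => min c.lo d.lo
  | loop c => c.lo

/-- Each stage writes only tables with numbers from `lo` on, so the results of earlier stages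
persist. -/
theorem Cmd.run_of_lt_lo (n : ℕ) {A : ℕ} (c : Cmd) (hA : A < c.lo) (M : Mem) :
    c.run n M A = M A := by
  induction c generalizing M with
  | tab B e =>
    have : A ≠ B := by rw [Cmd.lo] at hA; omega
    simp [Cmd.run, Mem.tab, this]
  | seq c d ihc ihd =>
    rw [Cmd.lo, lt_min_iff] at hA
    rw [Cmd.run, ihd hA.2, ihc hA.1]
  | loop c ih =>
    rw [Cmd.run]
    induction n with
    | zero => rfl
    | succ m _ =>
      have : ∀ k, (c.run (m + 1))^[k] M A = M A := by
        intro k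
        induction k with
        | zero => rfl
        | succ k ihk => rw [Function.iterate_succ_apply', ih hA, ihk]
      exact this _

theorem Cmd.run_tab_self {n : ℕ} (A : ℕ) (e : Term) (M : Mem) {i j : ℕ} (hi : i < n) (hj : j < n) :
    (tab A e).run n M A i j = e.val n M (rowCol n i j) := by
  simp [Cmd.run, Mem.tab, hi, hj]

theorem Cmd.run_tab_of_ne {n : ℕ} {A B : ℕ} (h : B ≠ A) (e : Term) (M : Mem) :
    (tab A e).run n M B = M B := by
  simp [Cmd.run, Mem.tab, h]

theorem Cmd.loop_induction {n : ℕ} {c : Cmd} {M : Mem} {Inv : ℕ → Mem → Prop} (h0 : Inv 0 M)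
    (hs : ∀ k M, Inv k M → Inv (k + 1) (c.run n M)) : Inv n ((loop c).run n M) := by
  have : ∀ k, Inv k ((c.run n)^[k] M) := by
    intro k
    induction k with
    | zero => exact h0
    | succ k ih => rw [Function.iterate_succ_apply']; exact hs _ _ ih
  exact this n

/-! ### Distances -/

/-- Computation of the distances (table `2`) from the adjacency matrix (table `0`). -/
def distCmd : Cmd :=
  .seq (.tab 1 (.eq (.var 0) (.var 1))) (.seq (.tab 2 (.num 0))
    (.loop (.seq (.tab 2 (.add (.get 2 (.var 0) (.var 1)) (not (.get 1 (.var 0) (.var 1)))))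
      (.tab 1 (or (.get 1 (.var 0) (.var 1))
        (ex (and (.get 1 (.var 1) (.var 0)) (.get 0 (.var 0) (.var 2)))))))))

section Stages

variable {n : ℕ} {G : SimpleGraph (Fin n)} {M : Mem}

theorem dist_le_succ_iff (hG : G.Connected) {i j : Fin n} {k : ℕ} :
    G.dist i j ≤ k + 1 ↔ G.dist i j ≤ k ∨ ∃ w, G.dist i w ≤ k ∧ G.Adj w j := by
  constructor
  · intro h
    by_cases hk : G.dist i j ≤ k
    · exact Or.inl hk
    · have hij : i ≠ j := by rintro rfl; simp at hk
      obtain ⟨w, hw, hd⟩ := exists_adj_dist_add_one hG hij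
      exact Or.inr ⟨w, by omega, hw⟩
  · rintro (h | ⟨w, hw, ha⟩)
    · omega
    · have h1 := hG.dist_triangle (u := i) (v := w) (w := j)
      have h2 : G.dist w j = 1 := SimpleGraph.dist_eq_one_iff_adj.2 ha
      omega

/-- After k rounds table 1 marks the pairs at distance at most k. Table 2 counts the rounds that
found a pair unmarked, which gives min(dist, k); distances are below n, so n rounds are enough. -/
theorem run_distCmd (hG : G.Connected) (hM : ∀ i j : Fin n, M 0 i j ≠ 0 ↔ G.Adj i j)
    (i j : Fin n) : distCmd.run n M 2 i j = G.dist i j := by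
  have key := Cmd.loop_induction (n := n)
    (c := .seq (.tab 2 (.add (.get 2 (.var 0) (.var 1)) (not (.get 1 (.var 0) (.var 1)))))
      (.tab 1 (or (.get 1 (.var 0) (.var 1))
        (ex (and (.get 1 (.var 1) (.var 0)) (.get 0 (.var 0) (.var 2)))))))
    (M := (Cmd.tab 2 (.num 0)).run n ((Cmd.tab 1 (.eq (.var 0) (.var 1))).run n M))
    (Inv := fun k M' => M' 0 = M 0 ∧ (∀ i j : Fin n, M' 1 i j ≠ 0 ↔ G.dist i j ≤ k) ∧
      ∀ i j : Fin n, M' 2 i j = min (G.dist i j) k) ?_ ?_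
  · exact (key.2.2 i j).trans (min_eq_left (by
      have := dist_lt_card hG i j
      rw [Fintype.card_fin] at this
      omega))
  · refine ⟨?_, fun i j => ?_, fun i j => ?_⟩
    · rw [Cmd.run_tab_of_ne (by decide), Cmd.run_tab_of_ne (by decide)]
    · rw [Cmd.run_tab_of_ne (by decide), Cmd.run_tab_self _ _ _ i.2 j.2, val_eq_ne_zero,
        Nat.le_zero, hG.dist_eq_zero_iff]
      simp [Fin.ext_iff]
    · rw [Cmd.run_tab_self _ _ _ i.2 j.2]
      simp
  · rintro k M' ⟨h0, h1, h2⟩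
    rw [Cmd.run]
    refine ⟨?_, fun i j => ?_, fun i j => ?_⟩
    · rw [Cmd.run_tab_of_ne (by decide), Cmd.run_tab_of_ne (by decide), h0]
    · rw [Cmd.run_tab_self _ _ _ i.2 j.2]
      simp only [val_or_ne_zero, val_ex_ne_zero, val_and_ne_zero, val_get, val_var, rowCol_zero,
        rowCol_one, scons_zero, scons_one, scons_two]
      rw [Cmd.run_tab_of_ne (by decide), Cmd.run_tab_of_ne (by decide), h0, dist_le_succ_iff hG, h1]
      simp only [h1, hM]
    · rw [Cmd.run_tab_of_ne (by decide), Cmd.run_tab_self _ _ _ i.2 j.2, val_add, val_get, val_var,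
        val_var, rowCol_zero, rowCol_one, h2]
      by_cases hk : G.dist i j ≤ k
      · have : (not (.get 1 (.var 0) (.var 1))).val n M' (rowCol n i j) = 0 := by
          rw [← not_ne_iff, val_not_ne_zero, not_not]
          exact (h1 i j).2 hk
        omega
      · have : (not (.get 1 (.var 0) (.var 1))).val n M' (rowCol n i j) = 1 := by
          have := (h1 i j).not.2 hk
          simp only [not_ne_iff] at this
          simp [Term.not, val, this]
        omega

end Stages
end AgedLabeling

/-! ### Correctness of the stages of the algorithm. -/

namespace AgedLabeling
open Term

/-! ### Diameter and smallest ball -/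

/-- The diameter. -/
def diamTerm : Term := .get 3 (.num 0) (.num 0)

/-- The radius of the balls. -/
def radTerm : Term := .get 4 (.num 0) (.num 0)

/-- Computation of the diameter `D` (table `3`), the radius `D / q` (table `4`), the sizes of the
balls of this radius (table `5`) and a smallest ball (table `6`). -/
def ballCmd (q : ℕ) : Cmd :=
  .seq (.tab 3 (count (ex (ex (.lt (.var 2) (.get 2 (.var 1) (.var 0)))))))
    (.seq (.tab 4 (count (le (nsmul q (.add (.var 0) (.num 1))) diamTerm)))
      (.seq (.tab 5 (count (le (.get 2 (.var 2) (.var 0)) radTerm)))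
        (.tab 6 (le (.get 2 (first (not (ex
          (.lt (.get 5 (.num 0) (.var 0)) (.get 5 (.num 0) (.var 1)))))) (.var 1)) radTerm))))

section Stages

variable {n : ℕ} {G : SimpleGraph (Fin n)} {M : Mem}

theorem run_ballCmd (hG : G.Connected) {q : ℕ} (hq : 0 < q)
    (hd : ∀ i j : Fin n, M 2 i j = G.dist i j) :
    (ballCmd q).run n M 3 0 0 = G.diam ∧ (ballCmd q).run n M 4 0 0 = G.diam / q ∧
    ∃ v₀ : Fin n, (∀ j : Fin n, (ballCmd q).run n M 6 0 j ≠ 0 ↔ j ∈ ballSet G (G.diam / q) v₀) ∧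
      ∀ v, (ballSet G (G.diam / q) v₀).card ≤ (ballSet G (G.diam / q) v).card := by
  classical
  have hne := hG.nonempty
  have hn : 0 < n := by obtain ⟨v⟩ := hne; exact v.pos
  have hD := diam_lt_card hG
  rw [Fintype.card_fin] at hD
  simp only [ballCmd, Cmd.run.eq_2]
  set M1 := (Cmd.tab 3 _).run n M with hM1
  set M2 := (Cmd.tab 4 _).run n M1 with hM2
  set M3 := (Cmd.tab 5 _).run n M2 with hM3
  set M4 := (Cmd.tab 6 _).run n M3 with hM4
  have d1 : ∀ i j : Fin n, M1 2 i j = G.dist i j := fun i j => by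
    rw [hM1, Cmd.run_tab_of_ne (by decide), hd]
  have d2 : ∀ i j : Fin n, M2 2 i j = G.dist i j := fun i j => by
    rw [hM2, Cmd.run_tab_of_ne (by decide), d1]
  have d3 : ∀ i j : Fin n, M3 2 i j = G.dist i j := fun i j => by
    rw [hM3, Cmd.run_tab_of_ne (by decide), d2]
  -- The diameter is below n, so it is the number of vertices k with k < dist(i, j) for some i, j.
  have D1 : M1 3 0 0 = G.diam := by
    rw [hM1, Cmd.run_tab_self _ _ _ hn hn]
    refine val_count_eq hD.le fun k => ?_
    simp only [val_ex_ne_zero, val_lt_ne_zero, val_var, val_get, scons_zero, scons_one, scons_two,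
      hd]
    constructor
    · rintro ⟨i, j, h⟩
      exact h.trans_le (dist_le_diam_of_connected hG i j)
    · intro h
      obtain ⟨i, j, hij⟩ := G.exists_dist_eq_diam
      exact ⟨i, j, by rwa [hij]⟩
  have D2 : M2 3 0 0 = G.diam := by rw [hM2, Cmd.run_tab_of_ne (by decide), D1]
  -- Division by counting: ⌊D / q⌋ is the number of k with q (k + 1) ≤ D.
  have R2 : M2 4 0 0 = G.diam / q := by
    rw [hM2, Cmd.run_tab_self _ _ _ hn hn]
    refine val_count_eq ((Nat.div_le_self _ _).trans hD.le) fun k => ?_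
    simp only [diamTerm, val_le_ne_zero, val_nsmul, val_add, val_var, val_num, val_get, scons_zero,
      D1]
    rw [← Nat.succ_le_iff, Nat.le_div_iff_mul_le hq, mul_comm]
  have R3 : M3 4 0 0 = G.diam / q := by rw [hM3, Cmd.run_tab_of_ne (by decide), R2]
  have B3 : ∀ j : Fin n, M3 5 0 j = (ballSet G (G.diam / q) j).card := fun j => by
    rw [hM3, Cmd.run_tab_self _ _ _ hn j.2, ballSet]
    refine val_count _ fun k => ?_
    simp [radTerm, d2, R2]
  refine ⟨?_, ?_, ?_⟩
  · rw [hM4, Cmd.run_tab_of_ne (by decide), hM3, Cmd.run_tab_of_ne (by decide), D2]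
  · rw [hM4, Cmd.run_tab_of_ne (by decide), R3]
  · have hfirst : ∀ j : Fin n, ∃ v : Fin n, (first (not (ex
        (.lt (.get 5 (.num 0) (.var 0)) (.get 5 (.num 0) (.var 1)))))).val n M3 (rowCol n 0 j) = v ∧
        ∀ w, (ballSet G (G.diam / q) v).card ≤ (ballSet G (G.diam / q) w).card := by
      intro j
      refine val_first (P := fun v =>
        ∀ w, (ballSet G (G.diam / q) v).card ≤ (ballSet G (G.diam / q) w).card) (fun w v => ?_) ?_
      · simp [-not_exists, B3, not_exists, not_lt]
      · obtain ⟨v, -, hv⟩ := Finset.exists_min_image Finset.univ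
          (fun v => (ballSet G (G.diam / q) v).card) Finset.univ_nonempty
        exact ⟨v, fun w => hv w (Finset.mem_univ _)⟩
    obtain ⟨v, hv, hmin⟩ := hfirst ⟨0, hn⟩
    refine ⟨v, fun j => ?_, hmin⟩
    rw [hM4, Cmd.run_tab_self _ _ _ hn j.2, val_le_ne_zero, val_get]
    have : (first (not (ex (.lt (.get 5 (.num 0) (.var 0)) (.get 5 (.num 0) (.var 1)))))).val n M3
        (rowCol n 0 j) = v := hv
    rw [this]
    simp [radTerm, d3, R3, mem_ballSet]

/-! ### Greedy dominating set -/

/-- Computation of a dominating set (table `7`) by the greedy algorithm. -/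
def greedyCmd : Cmd :=
  .seq (.tab 7 (.num 0)) (.loop
    (.seq (.tab 8 (not (ex (and (.get 7 (.num 0) (.var 0))
        (le (.get 2 (.var 0) (.var 2)) radTerm)))))
      (.seq (.tab 9 (count (and (.get 8 (.num 0) (.var 0))
          (le (.get 2 (.var 2) (.var 0)) radTerm))))
        (.tab 7 (or (.get 7 (.num 0) (.var 1)) (and (ex (.get 8 (.num 0) (.var 0)))
          (.eq (.var 1) (first (not (ex
            (.lt (.get 9 (.num 0) (.var 1)) (.get 9 (.num 0) (.var 0)))))))))))))

/-- The sets A k are read off table 7 after k rounds. In each round tables 8 and 9 hold the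
uncovered vertices and the gains, and the first vertex of maximal gain is added if some vertex is
uncovered. -/
theorem run_greedyCmd (hn : 0 < n) {ρ : ℕ} (hd : ∀ i j : Fin n, M 2 i j = G.dist i j)
    (hr : M 4 0 0 = ρ) :
    ∃ A : ℕ → Finset (Fin n), A 0 = ∅ ∧ (∀ i, GreedyStep G ρ (A i) (A (i + 1))) ∧
      ∀ j : Fin n, greedyCmd.run n M 7 0 j ≠ 0 ↔ j ∈ A n := by
  classical
  let c : Cmd := .seq (.tab 8 (not (ex (and (.get 7 (.num 0) (.var 0))
        (le (.get 2 (.var 0) (.var 2)) radTerm)))))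
      (.seq (.tab 9 (count (and (.get 8 (.num 0) (.var 0))
          (le (.get 2 (.var 2) (.var 0)) radTerm))))
        (.tab 7 (or (.get 7 (.num 0) (.var 1)) (and (ex (.get 8 (.num 0) (.var 0)))
          (.eq (.var 1) (first (not (ex
            (.lt (.get 9 (.num 0) (.var 1)) (.get 9 (.num 0) (.var 0)))))))))))
  let Mk : ℕ → Mem := fun k => (c.run n)^[k] ((Cmd.tab 7 (.num 0)).run n M)
  let A : ℕ → Finset (Fin n) := fun k => Finset.univ.filter fun j => Mk k 7 0 j ≠ 0
  have hlow : ∀ k B, B < 7 → Mk k B = M B := by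
    intro k B hB
    induction k with
    | zero => exact Cmd.run_tab_of_ne (by omega) _ _
    | succ k ih =>
      simp only [Mk] at ih ⊢
      rw [Function.iterate_succ_apply', Cmd.run_of_lt_lo n c (by simpa [c, Cmd.lo] using hB), ih]
  refine ⟨A, ?_, fun k => ?_, fun j => ?_⟩
  · refine Finset.filter_eq_empty_iff.2 fun j _ => ?_
    simp only [Mk, Function.iterate_zero, id]
    rw [Cmd.run_tab_self _ _ _ hn j.2]
    simp
  · have hstep : Mk (k + 1) = c.run n (Mk k) := Function.iterate_succ_apply' _ _ _
    have hd' : ∀ i j : Fin n, Mk k 2 i j = G.dist i j := fun i j => by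
      rw [hlow k 2 (by omega), hd]
    have hr' : Mk k 4 0 0 = ρ := by rw [hlow k 4 (by omega), hr]
    have hA : ∀ j : Fin n, Mk k 7 0 j ≠ 0 ↔ j ∈ A k := fun j => by simp [A]
    simp only [c, Cmd.run.eq_2] at hstep
    set N := Mk k with hN
    set M1 := (Cmd.tab 8 _).run n N with hM1
    set M2 := (Cmd.tab 9 _).run n M1 with hM2
    have low1 : ∀ B, B < 8 → M1 B = N B := fun B hB => Cmd.run_tab_of_ne (by omega) _ _
    have low2 : ∀ B, B < 9 → M2 B = M1 B := fun B hB => Cmd.run_tab_of_ne (by omega) _ _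
    have hu1 : ∀ j : Fin n, M1 8 0 j ≠ 0 ↔ j ∈ uncovered G ρ (A k) := fun j => by
      rw [hM1, Cmd.run_tab_self _ _ _ hn j.2, mem_uncovered]
      simp only [val_not_ne_zero, val_ex_ne_zero, val_and_ne_zero, val_le_ne_zero, val_get, val_num,
        val_var, scons_zero, scons_two, rowCol_one, hA, hd', radTerm, hr']
      simp
    have hg2 : ∀ j : Fin n, M2 9 0 j = gain G ρ (A k) j := fun j => by
      rw [hM2, Cmd.run_tab_self _ _ _ hn j.2]
      refine (val_count (fun x => x ∈ uncovered G ρ (A k) ∧ G.dist j x ≤ ρ) fun x => ?_).trans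
        (congrArg Finset.card ?_)
      · simp [radTerm, low1 2 (by omega), hd', low1 4 (by omega), hr', hu1]
      · ext x; simp
    have hfirst : ∀ j : Fin n, ∃ v : Fin n, (first (not (ex
        (.lt (.get 9 (.num 0) (.var 1)) (.get 9 (.num 0) (.var 0)))))).val n M2 (rowCol n 0 j) = v ∧
        ∀ w, gain G ρ (A k) w ≤ gain G ρ (A k) v := by
      intro j
      refine val_first (P := fun v => ∀ w, gain G ρ (A k) w ≤ gain G ρ (A k) v) (fun w v => ?_) ?_
      · simp [-not_exists, hg2, not_exists, not_lt]
      · obtain ⟨v, -, hv⟩ := Finset.exists_max_image Finset.univ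
          (fun v => gain G ρ (A k) v) ⟨⟨0, hn⟩, Finset.mem_univ _⟩
        exact ⟨v, fun w => hv w (Finset.mem_univ _)⟩
    obtain ⟨v, hv, hmax⟩ := hfirst ⟨0, hn⟩
    have hnext : ∀ j : Fin n, j ∈ A (k + 1) ↔
        j ∈ A k ∨ (uncovered G ρ (A k)).Nonempty ∧ j = v := fun j => by
      have : (first (not (ex
        (.lt (.get 9 (.num 0) (.var 1)) (.get 9 (.num 0) (.var 0)))))).val n M2 (rowCol n 0 j) = v :=
        hv
      have h7 : j ∈ A (k + 1) ↔ Mk (k + 1) 7 0 j ≠ 0 := by simp [A]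
      rw [h7, hstep, Cmd.run_tab_self _ _ _ hn j.2]
      simp only [val_or_ne_zero, val_and_ne_zero, val_ex_ne_zero, val_eq_ne_zero, this, val_get,
        val_num, val_var, rowCol_one, scons_zero, low2 8 (by omega), low2 7 (by omega),
        low1 7 (by omega), hA, hu1, Fin.ext_iff, Finset.Nonempty]
    refine ⟨fun h => ?_, fun h => ⟨v, ?_, hmax⟩⟩
    · ext j; rw [hnext, h]; simp
    · exact Finset.ext fun j => (hnext j).trans (Iff.trans (by tauto) Finset.mem_insert.symm)
  · simp only [A, Finset.mem_filter, Finset.mem_univ, true_and]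
    rfl

/-! ### Selection of the sets -/

/-- Selection of the sets `S` (table `12`) and `T` (table `13`) and of the radius (table `14`),
according to a condition (table `11`): a ball and all vertices if the condition holds, and otherwise
the dominating set for `S`, and for `T` if moreover `c = 0`. -/
def selectCmd (cond : Term) (c : ℕ) : Cmd :=
  .seq (.tab 11 cond) (.seq (.tab 12 (.ite (.get 11 (.num 0) (.num 0))
    (.get 6 (.num 0) (.var 1)) (.get 7 (.num 0) (.var 1))))
    (.seq (.tab 13 (.ite (or (.get 11 (.num 0) (.num 0)) (.num c)) (.num 1)
      (.get 7 (.num 0) (.var 1))))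
    (.tab 14 (.ite (or (.get 11 (.num 0) (.num 0)) (.num c)) (.sub diamTerm radTerm) radTerm))))

open Classical in
theorem run_selectCmd (hn : 0 < n) {cond : Term} {c D ρ : ℕ} {B A : Finset (Fin n)}
    (hD : M 3 0 0 = D) (hr : M 4 0 0 = ρ) (hB : ∀ j : Fin n, M 6 0 j ≠ 0 ↔ j ∈ B)
    (hA : ∀ j : Fin n, M 7 0 j ≠ 0 ↔ j ∈ A) {C : Prop}
    (hC : cond.val n M (rowCol n 0 0) ≠ 0 ↔ C) :
    (∀ j : Fin n, (selectCmd cond c).run n M 12 0 j ≠ 0 ↔ j ∈ if C then B else A) ∧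
    (∀ j : Fin n, (selectCmd cond c).run n M 13 0 j ≠ 0 ↔
      j ∈ if C ∨ c ≠ 0 then Finset.univ else A) ∧
    (selectCmd cond c).run n M 14 0 0 = if C ∨ c ≠ 0 then D - ρ else ρ := by
  simp only [selectCmd, Cmd.run.eq_2]
  set M1 := (Cmd.tab 11 _).run n M with hM1
  set M2 := (Cmd.tab 12 _).run n M1 with hM2
  set M3 := (Cmd.tab 13 _).run n M2 with hM3
  set M4 := (Cmd.tab 14 _).run n M3 with hM4
  have low1 : ∀ B, B < 11 → M1 B = M B := fun B hB => Cmd.run_tab_of_ne (by omega) _ _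
  have low2 : ∀ B, B < 12 → M2 B = M1 B := fun B hB => Cmd.run_tab_of_ne (by omega) _ _
  have low3 : ∀ B, B < 13 → M3 B = M2 B := fun B hB => Cmd.run_tab_of_ne (by omega) _ _
  have low4 : ∀ B, B < 14 → M4 B = M3 B := fun B hB => Cmd.run_tab_of_ne (by omega) _ _
  have h11 : M1 11 0 0 ≠ 0 ↔ C := by rw [hM1, Cmd.run_tab_self _ _ _ hn hn, hC]
  refine ⟨fun j => ?_, fun j => ?_, ?_⟩
  · rw [low4 12 (by omega), low3 12 (by omega), hM2, Cmd.run_tab_self _ _ _ hn j.2]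
    by_cases h : C
    · simp only [val_ite, val_get, val_num, val_var, rowCol_one, if_pos h, if_pos (h11.2 h),
        low1 6 (by omega), hB]
    · simp only [val_ite, val_get, val_num, val_var, rowCol_one, if_neg h, if_neg (h11.not.2 h),
        low1 7 (by omega), hA]
  · rw [low4 13 (by omega), hM3, Cmd.run_tab_self _ _ _ hn j.2]
    have ho : (or (.get 11 (.num 0) (.num 0)) (.num c)).val n M2 (rowCol n 0 j) ≠ 0 ↔
        C ∨ c ≠ 0 := by
      rw [val_or_ne_zero, val_get, val_num, val_num, low2 11 (by omega), h11]
    by_cases h : C ∨ c ≠ 0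
    · simp only [val_ite, if_pos (ho.2 h), if_pos h]
      simp
    · simp only [val_ite, if_neg (ho.not.2 h), if_neg h, val_get, val_num, val_var, rowCol_one,
        low2 7 (by omega), low1 7 (by omega), hA]
  · rw [hM4, Cmd.run_tab_self _ _ _ hn hn]
    have ho : (or (.get 11 (.num 0) (.num 0)) (.num c)).val n M3 (rowCol n 0 0) ≠ 0 ↔
        C ∨ c ≠ 0 := by
      rw [val_or_ne_zero, val_get, val_num, val_num, low3 11 (by omega), low2 11 (by omega), h11]
    have hD3 : M3 3 0 0 = D := by
      rw [low3 3 (by omega), low2 3 (by omega), low1 3 (by omega), hD]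
    have hr3 : M3 4 0 0 = ρ := by
      rw [low3 4 (by omega), low2 4 (by omega), low1 4 (by omega), hr]
    simp only [val_ite, ho, diamTerm, radTerm, val_sub, val_get, val_num, hD3, hr3]

/-! ### Trees -/

/-- Distance to the set in table `A`. -/
def setDistTerm (A : ℕ) : Term :=
  count (not (ex (and (.get A (.num 0) (.var 0)) (le (.get 2 (.var 0) (.var 3)) (.var 1)))))

/-- A neighbor that is closer to the set, where table `A` contains the distances to the set. -/
def nextTerm (A : ℕ) : Term :=
  first (and (.get 0 (.var 0) (.var 3))
    (.eq (.add (.get A (.num 0) (.var 0)) (.num 1)) (.get A (.num 0) (.var 3))))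

/-- The parent of the column in a tree of shortest paths from the row. -/
def parentTerm : Term :=
  .ite (.eq (.var 0) (.var 1)) (.var 0) (first (and (.get 0 (.var 0) (.var 3))
    (.eq (.add (.get 2 (.var 2) (.var 0)) (.num 1)) (.get 2 (.var 2) (.var 3)))))

/-- Computation of the distances to `S` and `T` (tables `15` and `16`), of neighbors that are closer
to these sets (tables `17` and `18`), and of trees of shortest paths (table `19`). -/
def treeCmd : Cmd :=
  .seq (.tab 15 (setDistTerm 12)) (.seq (.tab 16 (setDistTerm 13)) (.seq (.tab 17 (nextTerm 15))
    (.seq (.tab 18 (nextTerm 16)) (.tab 19 parentTerm))))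

/-- The distance is below n, hence equal to the number of k such that no vertex of the set is within
distance k. -/
theorem val_setDistTerm (hG : G.Connected) (hd : ∀ i j : Fin n, M 2 i j = G.dist i j) {A : ℕ}
    {S : Finset (Fin n)} (hS : S.Nonempty) (hA : ∀ j : Fin n, M A 0 j ≠ 0 ↔ j ∈ S) (i : ℕ) (j : Fin n) :
    (setDistTerm A).val n M (rowCol n i j) = setDist G S j := by
  refine val_count_eq ?_ fun k => ?_
  · obtain ⟨s, hs⟩ := hS
    have h1 := (setDist_le_iff (G := G) ⟨s, hs⟩).2 ⟨s, hs, le_refl (G.dist s j)⟩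
    have h2 := dist_lt_card hG s j
    rw [Fintype.card_fin] at h2
    omega
  · rw [← not_le, setDist_le_iff hS]
    simp [hA, hd]

theorem val_nextTerm (hG : G.Connected) (hadj : ∀ i j : Fin n, M 0 i j ≠ 0 ↔ G.Adj i j) {A : ℕ}
    {S : Finset (Fin n)} (hS : S.Nonempty) (hA : ∀ j : Fin n, M A 0 j = setDist G S j)
    (i : ℕ) (j : Fin n) (h : 0 < setDist G S j) :
    ∃ w : Fin n, (nextTerm A).val n M (rowCol n i j) = w ∧ G.Adj w j ∧
      setDist G S w + 1 = setDist G S j := by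
  refine val_first (fun w v => ?_) (exists_adj_setDist_add_one hG hS h)
  simp [hadj, hA]

theorem val_parentTerm (hG : G.Connected) (hadj : ∀ i j : Fin n, M 0 i j ≠ 0 ↔ G.Adj i j)
    (hd : ∀ i j : Fin n, M 2 i j = G.dist i j) (i j : Fin n) :
    ∃ w : Fin n, parentTerm.val n M (rowCol n i j) = w ∧ (i = j → w = i) ∧
      (i ≠ j → G.Adj w j ∧ G.dist i w + 1 = G.dist i j) := by
  by_cases h : i = j
  · refine ⟨i, ?_, fun _ => rfl, fun h' => absurd h h'⟩
    rw [parentTerm, val_ite, if_pos (by simp [h])]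
    rfl
  · have hf : ∃ w : Fin n, (first (and (.get 0 (.var 0) (.var 3))
        (.eq (.add (.get 2 (.var 2) (.var 0)) (.num 1)) (.get 2 (.var 2) (.var 3))))).val n M
        (rowCol n i j) = w ∧ G.Adj w j ∧ G.dist i w + 1 = G.dist i j := by
      refine val_first (fun w v => ?_) (exists_adj_dist_add_one hG h)
      simp [hadj, hd]
    obtain ⟨w, hw, hw'⟩ := hf
    refine ⟨w, ?_, fun h' => absurd h' h, fun _ => hw'⟩
    rw [parentTerm, val_ite, if_neg (by simpa [Fin.ext_iff] using h), hw]

theorem run_treeCmd (hG : G.Connected) (hadj : ∀ i j : Fin n, M 0 i j ≠ 0 ↔ G.Adj i j)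
    (hd : ∀ i j : Fin n, M 2 i j = G.dist i j) {S T : Finset (Fin n)} (hS : S.Nonempty)
    (hT : T.Nonempty) (hMS : ∀ j : Fin n, M 12 0 j ≠ 0 ↔ j ∈ S)
    (hMT : ∀ j : Fin n, M 13 0 j ≠ 0 ↔ j ∈ T) :
    (∀ j : Fin n, treeCmd.run n M 15 0 j = setDist G S j) ∧
    (∀ j : Fin n, treeCmd.run n M 16 0 j = setDist G T j) ∧
    (∃ f : Fin n → Fin n, ∀ j, 0 < setDist G S j → treeCmd.run n M 17 0 j = f j ∧
      G.Adj (f j) j ∧ setDist G S (f j) + 1 = setDist G S j) ∧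
    (∃ f : Fin n → Fin n, ∀ j, 0 < setDist G T j → treeCmd.run n M 18 0 j = f j ∧
      G.Adj (f j) j ∧ setDist G T (f j) + 1 = setDist G T j) ∧
    ∃ f : Fin n → Fin n → Fin n, (∀ i j : Fin n, treeCmd.run n M 19 i j = f i j) ∧
      (∀ i, f i i = i) ∧
      ∀ i j, i ≠ j → G.Adj (f i j) j ∧ G.dist i (f i j) + 1 = G.dist i j := by
  have hn : 0 < n := by obtain ⟨s, -⟩ := hS; exact s.pos
  simp only [treeCmd, Cmd.run.eq_2]
  set M1 := (Cmd.tab 15 _).run n M with hM1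
  set M2 := (Cmd.tab 16 _).run n M1 with hM2
  set M3 := (Cmd.tab 17 _).run n M2 with hM3
  set M4 := (Cmd.tab 18 _).run n M3 with hM4
  set M5 := (Cmd.tab 19 _).run n M4 with hM5
  have low1 : ∀ B, B < 15 → M1 B = M B := fun B hB => Cmd.run_tab_of_ne (by omega) _ _
  have low2 : ∀ B, B < 16 → M2 B = M1 B := fun B hB => Cmd.run_tab_of_ne (by omega) _ _
  have low3 : ∀ B, B < 17 → M3 B = M2 B := fun B hB => Cmd.run_tab_of_ne (by omega) _ _
  have low4 : ∀ B, B < 18 → M4 B = M3 B := fun B hB => Cmd.run_tab_of_ne (by omega) _ _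
  have low5 : ∀ B, B < 19 → M5 B = M4 B := fun B hB => Cmd.run_tab_of_ne (by omega) _ _
  have h15 : ∀ j : Fin n, M1 15 0 j = setDist G S j := fun j => by
    rw [hM1, Cmd.run_tab_self _ _ _ hn j.2, val_setDistTerm hG hd hS hMS]
  have h16 : ∀ j : Fin n, M2 16 0 j = setDist G T j := fun j => by
    rw [hM2, Cmd.run_tab_self _ _ _ hn j.2,
      val_setDistTerm hG (by rwa [low1 2 (by omega)]) hT (by rwa [low1 13 (by omega)])]
  have h17 : ∀ j : Fin n, ∃ w : Fin n, 0 < setDist G S j → M3 17 0 j = w ∧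
      G.Adj w j ∧ setDist G S w + 1 = setDist G S j := fun j => by
    by_cases h : 0 < setDist G S j
    · rw [hM3, Cmd.run_tab_self _ _ _ hn j.2]
      obtain ⟨w, hw⟩ := val_nextTerm (M := M2) (A := 15) hG
        (by rwa [low2 0 (by omega), low1 0 (by omega)]) hS (by rwa [low2 15 (by omega)]) 0 j h
      exact ⟨w, fun _ => hw⟩
    -- A vertex of S has no neighbor closer to S; the value there is never used.
    · exact ⟨j, fun h' => absurd h' h⟩
  have h18 : ∀ j : Fin n, ∃ w : Fin n, 0 < setDist G T j → M4 18 0 j = w ∧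
      G.Adj w j ∧ setDist G T w + 1 = setDist G T j := fun j => by
    by_cases h : 0 < setDist G T j
    · rw [hM4, Cmd.run_tab_self _ _ _ hn j.2]
      obtain ⟨w, hw⟩ := val_nextTerm (M := M3) (A := 16) hG
        (by rwa [low3 0 (by omega), low2 0 (by omega), low1 0 (by omega)]) hT
        (by rwa [low3 16 (by omega)]) 0 j h
      exact ⟨w, fun _ => hw⟩
    · exact ⟨j, fun h' => absurd h' h⟩
  have h19 : ∀ i j : Fin n, ∃ w : Fin n, M5 19 i j = w ∧ (i = j → w = i) ∧
      (i ≠ j → G.Adj w j ∧ G.dist i w + 1 = G.dist i j) := fun i j => by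
    rw [hM5, Cmd.run_tab_self _ _ _ i.2 j.2]
    exact val_parentTerm hG
      (by rwa [low4 0 (by omega), low3 0 (by omega), low2 0 (by omega), low1 0 (by omega)])
      (by rwa [low4 2 (by omega), low3 2 (by omega), low2 2 (by omega), low1 2 (by omega)]) i j
  choose f hf using h17
  choose g hg using h18
  choose p hp using h19
  refine ⟨?_, ?_, ⟨f, ?_⟩, ⟨g, ?_⟩, p, fun i j => (hp i j).1, fun i => (hp i i).2.1 rfl,
    fun i j => (hp i j).2.2⟩
  · rwa [low5 15 (by omega), low4 15 (by omega), low3 15 (by omega), low2 15 (by omega)]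
  · rwa [low5 16 (by omega), low4 16 (by omega), low3 16 (by omega)]
  · rwa [low5 17 (by omega), low4 17 (by omega)]
  · rwa [low5 18 (by omega)]

/-! ### Paths between the sets -/

/-- Computation of the vertices on the tree paths that lead from the row to a vertex of `T`
(table `21`). Meanwhile, table `20` contains the current ancestor of the column in the tree of the
row. -/
def pathCmd : Cmd :=
  .seq (.tab 20 (.var 1)) (.seq (.tab 21 (.num 0)) (.loop
    (.seq (.tab 21 (or (.get 21 (.var 0) (.var 1)) (ex (and (.get 13 (.num 0) (.var 0))
        (.eq (.get 20 (.var 1) (.var 0)) (.var 2))))))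
      (.tab 20 (.get 19 (.var 0) (.get 20 (.var 0) (.var 1)))))))

/-- Before round m, table 20 holds the m-th ancestors; the round marks those of the vertices of T in
table 21 and then moves one step up, so that n rounds mark all k < n. -/
theorem run_pathCmd {T : Finset (Fin n)} {p : Fin n → Fin n → Fin n}
    (hT : ∀ j : Fin n, M 13 0 j ≠ 0 ↔ j ∈ T) (hp : ∀ i j : Fin n, M 19 i j = p i j) (i j : Fin n) :
    pathCmd.run n M 21 i j ≠ 0 ↔ ∃ t ∈ T, ∃ k < n, (p i)^[k] t = j := by
  have key := Cmd.loop_induction (n := n)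
    (c := .seq (.tab 21 (or (.get 21 (.var 0) (.var 1)) (ex (and (.get 13 (.num 0) (.var 0))
        (.eq (.get 20 (.var 1) (.var 0)) (.var 2))))))
      (.tab 20 (.get 19 (.var 0) (.get 20 (.var 0) (.var 1)))))
    (M := (Cmd.tab 21 (.num 0)).run n ((Cmd.tab 20 (.var 1)).run n M))
    (Inv := fun m M' => M' 13 = M 13 ∧ M' 19 = M 19 ∧
      (∀ i j : Fin n, M' 20 i j = (p i)^[m] j) ∧
      ∀ i j : Fin n, M' 21 i j ≠ 0 ↔ ∃ t ∈ T, ∃ k < m, (p i)^[k] t = j) ?_ ?_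
  · exact key.2.2.2 i j
  · refine ⟨?_, ?_, fun i j => ?_, fun i j => ?_⟩
    · rw [Cmd.run_tab_of_ne (by decide), Cmd.run_tab_of_ne (by decide)]
    · rw [Cmd.run_tab_of_ne (by decide), Cmd.run_tab_of_ne (by decide)]
    · rw [Cmd.run_tab_of_ne (by decide), Cmd.run_tab_self _ _ _ i.2 j.2]
      rfl
    · rw [Cmd.run_tab_self _ _ _ i.2 j.2]
      simp
  · rintro m M' ⟨h1, h2, h3, h4⟩
    rw [Cmd.run]
    refine ⟨?_, ?_, fun i j => ?_, fun i j => ?_⟩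
    · rw [Cmd.run_tab_of_ne (by decide), Cmd.run_tab_of_ne (by decide), h1]
    · rw [Cmd.run_tab_of_ne (by decide), Cmd.run_tab_of_ne (by decide), h2]
    · rw [Cmd.run_tab_self _ _ _ i.2 j.2, Function.iterate_succ_apply']
      simp only [val_get, val_var, rowCol_zero, rowCol_one]
      rw [Cmd.run_tab_of_ne (by decide), Cmd.run_tab_of_ne (by decide), h3, h2, hp]
    · rw [Cmd.run_tab_of_ne (by decide), Cmd.run_tab_self _ _ _ i.2 j.2]
      simp only [val_or_ne_zero, val_ex_ne_zero, val_and_ne_zero, val_eq_ne_zero, val_get, val_var,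
        val_num, rowCol_zero, rowCol_one, scons_zero, scons_one, scons_two, h4, h1, hT, h3,
        Fin.val_inj]
      constructor
      · rintro (⟨t, ht, k, hk, h⟩ | ⟨t, ht, h⟩)
        · exact ⟨t, ht, k, by omega, h⟩
        · exact ⟨t, ht, m, by omega, h⟩
      · rintro ⟨t, ht, k, hk, h⟩
        rcases Nat.lt_succ_iff_lt_or_eq.1 hk with hk | rfl
        · exact Or.inl ⟨t, ht, k, hk, h⟩
        · exact Or.inr ⟨t, ht, h⟩

end Stages
end AgedLabeling

/-! ### The complete program, and the two approximation ratios. -/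

namespace AgedLabeling
open Term

/-! ### The algorithm -/

/-- The command that prepares the output. -/
def mainCmd (q : ℕ) (cond : Term) (c : ℕ) : Cmd :=
  .seq distCmd (.seq (ballCmd q) (.seq greedyCmd (.seq (selectCmd cond c) (.seq treeCmd pathCmd))))

/-- The labels on the walks to `S`. -/
def triplesIn : Triples where
  cond := and (.eq (.var 0) (.num 0)) (.lt (.num 0) (.get 15 (.num 0) (.var 1)))
  fst := .var 1
  snd := .get 17 (.num 0) (.var 1)
  label := .sub (.add (.get 14 (.num 0) (.num 0)) (.num 1)) (.get 15 (.num 0) (.var 1))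

/-- The labels on the paths from `S` to `T`. -/
def triplesMid : Triples where
  cond := and (.get 12 (.num 0) (.var 0)) (and (not (.eq (.var 0) (.var 1)))
    (.get 21 (.var 0) (.var 1)))
  fst := .get 19 (.var 0) (.var 1)
  snd := .var 1
  label := .add (.get 14 (.num 0) (.num 0)) (.get 2 (.var 0) (.var 1))

/-- The labels on the walks from `T`. -/
def triplesOut : Triples where
  cond := and (.eq (.var 0) (.num 0)) (.lt (.num 0) (.get 16 (.num 0) (.var 1)))
  fst := .get 18 (.num 0) (.var 1)
  snd := .var 1
  label := .add (.add (.get 14 (.num 0) (.num 0)) diamTerm) (.get 16 (.num 0) (.var 1))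

/-- The whole program. -/
def mainProg (q : ℕ) (cond : Term) (c : ℕ) : Prog :=
  outputProg (mainCmd q cond c) triplesIn triplesMid triplesOut

section Final

variable {n : ℕ} {G : SimpleGraph (Fin n)}

/-- The triples of a scheme. -/
def Scheme.triples (X : Scheme G) : Set (ℕ × ℕ × ℕ) :=
  {x | ∃ i ∈ X.index, x = (((X.pair i).1 : ℕ), ((X.pair i).2 : ℕ), X.label i)}

/-- Only the set of triples matters: their order and repetitions are irrelevant, and an edge may be
listed in either direction. -/
theorem Scheme.outputs (X : Scheme G) {s : State} (h0 : s.reg 0 = s.reg 2)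
    (hout : s.out = X.triples) : s.Outputs X.labeling := by
  constructor
  · intro k hk
    have : (s.arr 1 k 0, s.arr 1 k 1, s.arr 1 k 2) ∈ X.triples := by
      rw [← hout]
      exact ⟨k, by omega, rfl, rfl, rfl⟩
    obtain ⟨i, hi, hx⟩ := this
    simp only [Prod.mk.injEq] at hx
    exact ⟨_, _, X.adj_pair hi, hx.1, hx.2.1⟩
  · intro u v h t
    have hmem : t ∈ X.labeling ⟨s(u, v), h⟩ ↔ ((u : ℕ), (v : ℕ), t) ∈ X.triples ∨
        ((v : ℕ), (u : ℕ), t) ∈ X.triples := by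
      rw [Scheme.labeling, mem_labelingOf]
      simp only [Scheme.triples, Set.mem_ofPred_eq, Prod.mk.injEq, Fin.val_inj, ← exists_or,
        ← and_or_left]
      refine exists_congr fun i => and_congr_right fun _ => ?_
      rw [show Sym2.mk (X.pair i).1 (X.pair i).2 = s(u, v) ↔ _ from Sym2.eq_iff]
      constructor
      · rintro ⟨⟨h1, h2⟩ | ⟨h1, h2⟩, h3⟩
        · exact Or.inl ⟨h1.symm, h2.symm, h3.symm⟩
        · exact Or.inr ⟨h1.symm, h2.symm, h3.symm⟩
      · rintro (⟨h1, h2, h3⟩ | ⟨h1, h2, h3⟩)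
        · exact ⟨Or.inl ⟨h1.symm, h2.symm⟩, h3.symm⟩
        · exact ⟨Or.inr ⟨h1.symm, h2.symm⟩, h3.symm⟩
    rw [hmem, ← hout, h0]
    simp only [State.out, Set.mem_ofPred_eq, ← exists_or, ← and_or_left]
    refine exists_congr fun i => and_congr_right fun _ => ?_
    tauto

theorem exists_dist_eq_sub (hG : G.Connected) {u x : Fin n} {k : ℕ} (h : k ≤ G.dist u x) :
    ∃ y, G.dist u y = k ∧ G.dist y x = G.dist u x - k := by
  induction hm : G.dist u x - k generalizing x with
  | zero => exact ⟨x, by omega, by simp⟩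
  | succ m ih =>
    have hux : u ≠ x := by rintro rfl; simp at hm
    obtain ⟨w, hw, hd⟩ := exists_adj_dist_add_one hG hux
    obtain ⟨y, hy, hyw⟩ := ih (x := w) (by omega) (by omega)
    have h1 := hG.dist_triangle (u := y) (v := w) (w := x)
    have h2 := hG.dist_triangle (u := u) (v := y) (w := x)
    have h3 : G.dist w x = 1 := SimpleGraph.dist_eq_one_iff_adj.2 hw
    exact ⟨y, hy, by omega⟩

/-- For x outside the ball, take the vertex at distance ρ from v on a shortest path from v to x: it
lies in the ball, and the rest of the path has length at most D - ρ. -/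
theorem setDist_ballSet_le (hG : G.Connected) {ρ : ℕ} (hρ : ρ ≤ G.diam) (v x : Fin n) :
    setDist G (ballSet G ρ v) x ≤ G.diam - ρ := by
  have hne : (ballSet G ρ v).Nonempty := ⟨v, mem_ballSet.2 (by simp)⟩
  rw [setDist_le_iff hne]
  rcases le_total (G.dist v x) ρ with h | h
  · exact ⟨x, mem_ballSet.2 h, by simp⟩
  · obtain ⟨y, hy, hyx⟩ := exists_dist_eq_sub hG h
    have := dist_le_diam_of_connected hG v x
    exact ⟨y, mem_ballSet.2 hy.le, by omega⟩

open Classical in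
/-- On every connected graph, the program outputs the labeling of a scheme for the selected sets. -/
theorem exists_scheme (hG : G.Connected) (a : ℕ) {q : ℕ} (hq : 2 ≤ q) {cond : Term} {c : ℕ}
    {C : ℕ → ℕ → ℕ → Prop}
    (hC : ∀ (M : Mem) (B A : Finset (Fin n)), (∀ j : Fin n, M 6 0 j ≠ 0 ↔ j ∈ B) →
      (∀ j : Fin n, M 7 0 j ≠ 0 ↔ j ∈ A) → M 3 0 0 = G.diam →
      (cond.val n M (rowCol n 0 0) ≠ 0 ↔ C B.card A.card G.diam)) :
    ∃ (k : ℕ) (A : Finset (Fin n)) (X : Scheme G), 0 < k ∧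
      (A.card : ℝ) ≤ n * Real.log n / k + 1 ∧
      (∀ x, setDist G A x ≤ G.diam / q) ∧
      (C k A.card G.diam → X.S.card = k) ∧ (¬ C k A.card G.diam → X.S = A) ∧
      (C k A.card G.diam ∨ c ≠ 0 → X.T = Finset.univ ∧ X.r = G.diam - G.diam / q) ∧
      (¬ (C k A.card G.diam ∨ c ≠ 0) → X.T = A ∧ X.r = G.diam / q) ∧
      X.mid.card ≤ X.S.card * n ∧ X.mid.card ≤ X.S.card * (X.T.card * G.diam) ∧
      Halts (mainProg q cond c) (input G a) (((mainCmd q cond c).time +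
        (triplesIn.time + (triplesMid.time + (triplesOut.time + 2)))).eval n)
        fun s => s.Outputs X.labeling := by
  have hne := hG.nonempty
  have hn : 0 < n := by obtain ⟨v⟩ := hne; exact v.pos
  have hρD : G.diam / q ≤ G.diam - G.diam / q := by
    have h1 : G.diam / q ≤ G.diam / 2 := Nat.div_le_div_left hq (by omega)
    omega
  have hhalt := halts_outputProg (mainCmd q cond c) triplesIn triplesMid triplesOut
    (n := n) (s := input G a) rfl rfl
  have hadj : ∀ i j : Fin n, (input G a).mem arrayOf 0 i j ≠ 0 ↔ G.Adj i j := fun i j => by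
    simp [State.mem, arrayOf, input]
  -- After each stage the memory is replaced by a variable, so that only the stated facts about its
  -- tables remain.
  generalize (input G a).mem arrayOf = M0 at hhalt hadj
  simp only [mainCmd, Cmd.run.eq_2] at hhalt
  have d1 := run_distCmd hG hadj
  have low1 : ∀ B, B < 1 → distCmd.run n M0 B = M0 B := fun B hB => Cmd.run_of_lt_lo n _ hB _
  generalize distCmd.run n M0 = M1 at hhalt d1 low1
  obtain ⟨D2, r2, v₀, hB, hmin⟩ := run_ballCmd (M := M1) hG (q := q) (by omega) d1
  have low2 : ∀ B, B < 3 → (ballCmd q).run n M1 B = M1 B := fun B hB => Cmd.run_of_lt_lo n _ hB _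
  generalize (ballCmd q).run n M1 = M2 at hhalt D2 r2 hB low2
  obtain ⟨As, hA0, hAs, hA⟩ := run_greedyCmd (M := M2) (G := G) hn
    (by rwa [low2 2 (by omega)]) r2
  have low3 : ∀ B, B < 7 → greedyCmd.run n M2 B = M2 B := fun B hB => Cmd.run_of_lt_lo n _ hB _
  generalize greedyCmd.run n M2 = M3 at hhalt hA low3
  set B := ballSet G (G.diam / q) v₀ with hBdef
  have hBne : B.Nonempty := ⟨v₀, mem_ballSet.2 (by simp)⟩
  have hk0 : 0 < B.card := hBne.card_pos
  have hcard : (Fintype.card (Fin n)) = n := Fintype.card_fin n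
  -- B is a smallest ball, so `B.card` serves as the lower bound for all balls in the greedy
  -- analysis.
  have hAunc : uncovered G (G.diam / q) (As n) = ∅ := by
    have := uncovered_greedy_card hmin hk0 hAs
    rwa [hcard] at this
  have hAcard : ((As n).card : ℝ) ≤ n * Real.log n / B.card + 1 := by
    have := card_greedy_card_le hmin hk0 hA0 hAs hne
    rwa [hcard] at this
  set A := As n with hAdef
  have hAdom : ∀ x, ∃ s ∈ A, G.dist s x ≤ G.diam / q := fun x => by
    by_contra hx
    push Not at hx
    have : x ∈ uncovered G (G.diam / q) A := mem_uncovered.2 fun s hs => not_le.2 (hx s hs)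
    rw [hAunc] at this
    simp at this
  have hAne : A.Nonempty := by
    obtain ⟨s, hs, -⟩ := hAdom v₀
    exact ⟨s, hs⟩
  have hAdist : ∀ x, setDist G A x ≤ G.diam / q := fun x => (setDist_le_iff hAne).2 (hAdom x)
  set Cp : Prop := C B.card A.card G.diam with hCp
  obtain ⟨hS, hT, hr⟩ := run_selectCmd (M := M3) hn (cond := cond) (c := c)
    (D := G.diam) (ρ := G.diam / q)
    (by rw [low3 3 (by omega)]; exact D2) (by rw [low3 4 (by omega)]; exact r2)
    (by rwa [low3 6 (by omega)]) hA
    (hC M3 B A (by rwa [low3 6 (by omega)]) hA (by rw [low3 3 (by omega)]; exact D2))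
  have low4 : ∀ B, B < 11 → (selectCmd cond c).run n M3 B = M3 B :=
    fun B hB => Cmd.run_of_lt_lo n _ hB _
  generalize (selectCmd cond c).run n M3 = M4 at hhalt hS hT hr low4
  set S : Finset (Fin n) := if Cp then B else A with hSdef
  set T : Finset (Fin n) := if Cp ∨ c ≠ 0 then Finset.univ else A with hTdef
  set r : ℕ := if Cp ∨ c ≠ 0 then G.diam - G.diam / q else G.diam / q with hrdef
  have hSne : S.Nonempty := by rw [hSdef]; split_ifs <;> assumption
  have hTne : T.Nonempty := by
    rw [hTdef]; split_ifs
    · exact Finset.univ_nonempty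
    · exact hAne
  -- With S = A the distance is at most ρ. If T is the whole vertex set, r is D - ρ nevertheless,
  -- which is no smaller because q ≥ 2.
  have hSr : ∀ x, setDist G S x ≤ r := fun x => by
    rw [hSdef, hrdef]
    by_cases h : Cp
    · rw [if_pos h, if_pos (Or.inl h)]
      exact setDist_ballSet_le hG (Nat.div_le_self _ _) v₀ x
    · rw [if_neg h]
      refine (hAdist x).trans ?_
      split_ifs <;> omega
  have e4 : ∀ B, B < 3 → M4 B = M1 B := fun B hB => by
    rw [low4 B (by omega), low3 B (by omega), low2 B hB]
  obtain ⟨hdS, hdT, ⟨f, hf⟩, ⟨g, hg⟩, p, hp, hself, hpar⟩ := run_treeCmd (M := M4) hG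
    (by rwa [e4 0 (by omega), low1 0 (by omega)]) (by rwa [e4 2 (by omega)]) hSne hTne hS hT
  have low5 : ∀ B, B < 15 → treeCmd.run n M4 B = M4 B := fun B hB => Cmd.run_of_lt_lo n _ hB _
  generalize treeCmd.run n M4 = M5 at hhalt hdS hdT hf hg hp low5
  have hmid := run_pathCmd (M := M5) (by rwa [low5 13 (by omega)]) hp
  have low6 : ∀ B, B < 20 → pathCmd.run n M5 B = M5 B := fun B hB => Cmd.run_of_lt_lo n _ hB _
  generalize pathCmd.run n M5 = M6 at hhalt hmid low6
  have m2 : ∀ i j : Fin n, M6 2 i j = G.dist i j := by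
    rwa [low6 2 (by omega), low5 2 (by omega), e4 2 (by omega)]
  have m3 : M6 3 0 0 = G.diam := by
    rw [low6 3 (by omega), low5 3 (by omega), low4 3 (by omega), low3 3 (by omega)]
    exact D2
  have m12 : ∀ j : Fin n, M6 12 0 j ≠ 0 ↔ j ∈ S := by
    rwa [low6 12 (by omega), low5 12 (by omega)]
  have m14 : M6 14 0 0 = r := by rwa [low6 14 (by omega), low5 14 (by omega)]
  rw [← low6 15 (by omega)] at hdS
  rw [← low6 16 (by omega)] at hdT
  rw [← low6 17 (by omega)] at hf
  rw [← low6 18 (by omega)] at hg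
  rw [← low6 19 (by omega)] at hp
  let X : Scheme G := Scheme.ofParent hG S T r f g p hSne hTne hSr (fun x hx => (hf x hx).2)
    (fun x hx => (hg x hx).2) hself hpar
  have tIn : ∀ x, x ∈ triplesIn.toSet n M6 ↔ ∃ j : Fin n, 0 < setDist G S j ∧
      x = ((j : ℕ), (f j : ℕ), r + 1 - setDist G S j) := by
    intro x
    constructor
    · rintro ⟨i, hi, j, hj, hc, rfl⟩
      lift j to Fin n using hj
      simp only [triplesIn, val_and_ne_zero, val_lt_ne_zero, val_eq_ne_zero, val_get, val_num,
        val_var, rowCol_one, rowCol_zero, hdS] at hc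
      refine ⟨j, hc.2, ?_⟩
      simp [triplesIn, hdS, m14, (hf j hc.2).1]
    · rintro ⟨j, hj, rfl⟩
      refine ⟨0, hn, j, j.2, ?_, ?_⟩
      · simp only [triplesIn, val_and_ne_zero, val_lt_ne_zero, val_eq_ne_zero, val_get, val_num,
          val_var, rowCol_one, rowCol_zero, hdS]
        exact ⟨trivial, hj⟩
      · simp [triplesIn, hdS, m14, (hf j hj).1]
  have tOut : ∀ x, x ∈ triplesOut.toSet n M6 ↔ ∃ j : Fin n, 0 < setDist G T j ∧
      x = ((g j : ℕ), (j : ℕ), r + G.diam + setDist G T j) := by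
    intro x
    constructor
    · rintro ⟨i, hi, j, hj, hc, rfl⟩
      lift j to Fin n using hj
      simp only [triplesOut, val_and_ne_zero, val_lt_ne_zero, val_eq_ne_zero, val_get, val_num,
        val_var, rowCol_one, rowCol_zero, hdT] at hc
      refine ⟨j, hc.2, ?_⟩
      simp [triplesOut, diamTerm, hdT, m14, m3, (hg j hc.2).1]
    · rintro ⟨j, hj, rfl⟩
      refine ⟨0, hn, j, j.2, ?_, ?_⟩
      · simp only [triplesOut, val_and_ne_zero, val_lt_ne_zero, val_eq_ne_zero, val_get, val_num,
          val_var, rowCol_one, rowCol_zero, hdT]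
        exact ⟨trivial, hj⟩
      · simp [triplesOut, diamTerm, hdT, m14, m3, (hg j hj).1]
  have tMid : ∀ x, x ∈ triplesMid.toSet n M6 ↔ ∃ y : Fin n × Fin n, y ∈ midSet S T p ∧
      x = ((p y.1 y.2 : ℕ), (y.2 : ℕ), r + G.dist y.1 y.2) := by
    have hc : ∀ i j : Fin n, triplesMid.cond.val n M6 (rowCol n i j) ≠ 0 ↔
        (i, j) ∈ midSet S T p := fun i j => by
      simp only [triplesMid, val_and_ne_zero, val_not_ne_zero, val_eq_ne_zero, val_get, val_num,
        val_var, rowCol_one, rowCol_zero, m12, hmid, mem_midSet, hcard, Fin.val_inj, ne_eq]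
    intro x
    constructor
    · rintro ⟨i, hi, j, hj, hx, rfl⟩
      lift i to Fin n using hi
      lift j to Fin n using hj
      exact ⟨(i, j), (hc i j).1 hx, by simp [triplesMid, m14, m2, hp]⟩
    · rintro ⟨⟨i, j⟩, hy, rfl⟩
      exact ⟨i, i.2, j, j.2, (hc i j).2 hy, by simp [triplesMid, m14, m2, hp]⟩
  have hset : triplesIn.toSet n M6 ∪ triplesMid.toSet n M6 ∪ triplesOut.toSet n M6 = X.triples := by
    ext x
    rw [Set.mem_union, Set.mem_union, tIn, tMid, tOut]
    have hidx : ∀ i, i ∈ X.index ↔ (match i with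
        | .inl y => 0 < setDist G S y
        | .inr (.inl y) => y ∈ midSet S T p
        | .inr (.inr y) => 0 < setDist G T y) := by
      rintro (y | y | y) <;> simp [Scheme.index, X, Scheme.ofParent]
    constructor
    · rintro ((⟨y, hy, rfl⟩ | ⟨y, hy, rfl⟩) | ⟨y, hy, rfl⟩)
      · exact ⟨.inl y, (hidx _).2 hy, rfl⟩
      · exact ⟨.inr (.inl y), (hidx _).2 hy, rfl⟩
      · exact ⟨.inr (.inr y), (hidx _).2 hy, rfl⟩
    · rintro ⟨y | y | y, hy, rfl⟩
      · exact Or.inl (Or.inl ⟨y, (hidx _).1 hy, rfl⟩)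
      · exact Or.inl (Or.inr ⟨y, (hidx _).1 hy, rfl⟩)
      · exact Or.inr ⟨y, (hidx _).1 hy, rfl⟩
  refine ⟨B.card, A, X, hk0, hAcard, hAdist, fun h => ?_, fun h => ?_, fun h => ⟨?_, ?_⟩,
    fun h => ⟨?_, ?_⟩, ?_, ?_, ?_⟩
  · exact congrArg Finset.card (if_pos h)
  · exact if_neg h
  · exact if_pos h
  · exact if_pos h
  · exact if_neg h
  · exact if_neg h
  · have := card_midSet_le_mul_card (parent := p) S T
    rwa [hcard] at this
  · exact card_midSet_le_mul_diam hG hself hpar S T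
  · exact hhalt.mono le_rfl fun s hs => X.outputs hs.1 (hs.2.trans hset)

/-- Compare the sizes of the ball and of the dominating set. -/
def sizeCond : Term :=
  le (count (.get 6 (.num 0) (.var 0))) (count (.get 7 (.num 0) (.var 0)))

/-- Compare the number of labels needed with the ball and with the dominating set. -/
def costCond : Term :=
  le (.sum (count (.get 6 (.num 0) (.var 0)))) (.sum (.sum (.ite (and (.get 7 (.num 0) (.var 1))
    (.get 7 (.num 0) (.var 0))) diamTerm (.num 0))))

theorem val_count_get {M : Mem} {i : ℕ} {A : Finset (Fin n)} (hA : ∀ j : Fin n, M i 0 j ≠ 0 ↔ j ∈ A)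
    (ρ : ℕ → ℕ) : (count (.get i (.num 0) (.var 0))).val n M ρ = A.card := by
  classical
  rw [val_count (fun j => j ∈ A) (by simpa using hA), Finset.filter_mem_eq_inter,
    Finset.univ_inter]

theorem val_sizeCond {M : Mem} {B A : Finset (Fin n)} (hB : ∀ j : Fin n, M 6 0 j ≠ 0 ↔ j ∈ B)
    (hA : ∀ j : Fin n, M 7 0 j ≠ 0 ↔ j ∈ A) (ρ : ℕ → ℕ) :
    sizeCond.val n M ρ ≠ 0 ↔ B.card ≤ A.card := by
  rw [sizeCond, val_le_ne_zero, val_count_get hB, val_count_get hA]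

/-- The machine has no multiplication, so the products n |B| and |A|² D are computed as iterated
sums over the vertices. -/
theorem val_costCond {M : Mem} {B A : Finset (Fin n)} (hB : ∀ j : Fin n, M 6 0 j ≠ 0 ↔ j ∈ B)
    (hA : ∀ j : Fin n, M 7 0 j ≠ 0 ↔ j ∈ A) {D : ℕ} (hD : M 3 0 0 = D) (ρ : ℕ → ℕ) :
    costCond.val n M ρ ≠ 0 ↔ n * B.card ≤ A.card * A.card * D := by
  classical
  have h1 : ∀ i j : Fin n, Term.val n M (.ite (and (.get 7 (.num 0) (.var 1))
      (.get 7 (.num 0) (.var 0))) diamTerm (.num 0)) (scons j (scons i ρ)) =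
      if i ∈ A then if j ∈ A then D else 0 else 0 := by
    intro i j
    simp only [val_ite, val_and_ne_zero, val_get, val_num, val_var, scons_zero, scons_one, hA,
      diamTerm, hD]
    split_ifs <;> tauto
  rw [costCond, val_le_ne_zero, val_sum, val_sum]
  simp only [val_count_get hB, val_sum, h1]
  simp [mul_assoc]

end Final

theorem card_sub_one_le {n : ℕ} {G : SimpleGraph (Fin n)} (hG : G.Connected) {a : ℕ} (hn : 2 ≤ n)
    {mu : Labeling G} (hmu : Feasible G a mu) : (n : ℝ) ≤ 2 * mu.size := by
  have h1 := hmu.card_le_size_add_one hG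
  rw [Fintype.card_fin] at h1
  exact_mod_cast (show n ≤ 2 * mu.size by omega)

theorem size_eq_zero_of_card_le_one {n : ℕ} {G : SimpleGraph (Fin n)} (hn : n ≤ 1)
    (lam : Labeling G) : lam.size = 0 := by
  classical
  have : IsEmpty G.edgeSet := by
    refine ⟨fun ⟨e, he⟩ => ?_⟩
    induction e with
    | _ u v => exact G.ne_of_adj he (Fin.ext (by omega))
  simp [Labeling.size]

/-- Here `c = 1` forces T = V, so that only S depends on the comparison. The constant 8 combines 2 n
+ 2 n √(n log n) ≤ 4 n √(n log n) with n ≤ 2 |mu|. -/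
theorem hasPolyTimeApprox_sqrt : HasPolyTimeApprox
    (fun _ G a => ⌈(3 / 2 : ℝ) * (G.diam : ℝ)⌉ ≤ (a : ℤ))
    (fun n _ => Real.sqrt ((n : ℝ) * Real.log n)) := by
  classical
  refine ⟨mainProg 2 sizeCond 1, (mainCmd 2 sizeCond 1).time +
    (triplesIn.time + (triplesMid.time + (triplesOut.time + 2))), 8, ?_⟩
  intro n G a hG ha
  obtain ⟨k, A, X, hk, hA, -, hS1, hS2, hT, -, hmid, -, s, t, hex, ht, hout⟩ := exists_scheme hG a
    (le_refl 2) (cond := sizeCond) (c := 1) (C := fun b g _ => b ≤ g)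
    (fun M B A hB hA _ => val_sizeCond hB hA _)
  obtain ⟨hT, hr⟩ := hT (Or.inr one_ne_zero)
  -- The lifetime r + D with r = D - ⌊D / 2⌋, which equals ⌈3 D / 2⌉.
  have hdiam : 2 * G.diam - G.diam / 2 ≤ a := by
    have h1 : (3 / 2 : ℝ) * G.diam ≤ a := by exact_mod_cast Int.ceil_le.1 ha
    have h2 : 3 * G.diam ≤ 2 * a := by
      have : (3 : ℝ) * G.diam ≤ 2 * a := by linarith
      exact_mod_cast this
    omega
  refine ⟨s, t, hex, ht, X.labeling, hout, X.feasible_labeling hG fun x => ?_, fun mu hmu => ?_⟩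
  · have : setDist G X.T x = 0 := (setDist_eq_zero hG X.T_nonempty).2 (by rw [hT]; simp)
    omega
  -- For a single vertex no label is needed; for n ≥ 2 the bound n - 1 ≤ |mu| gives n ≤ 2 |mu|.
  · rcases le_or_gt n 1 with hn | hn
    · rw [size_eq_zero_of_card_le_one hn, Nat.cast_zero]
      positivity
    · have hn2 : (2 : ℝ) ≤ n := by exact_mod_cast hn
      have hopt := card_sub_one_le hG hn hmu
      have hmin := min_le_two_mul_sqrt hn2 (Nat.cast_pos.2 hk) hA
      have hs : 1 ≤ √((n : ℝ) * Real.log n) := Real.one_le_sqrt.2 (one_le_mul_log hn2)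
      have hScard : (X.S.card : ℝ) ≤ min (k : ℝ) A.card := by
        by_cases h : k ≤ A.card
        · rw [hS1 h, min_eq_left (by exact_mod_cast h)]
        · rw [hS2 h, min_eq_right (by exact_mod_cast (not_le.1 h).le)]
      have hsize : (X.labeling.size : ℝ) ≤ 2 * n + X.S.card * n := by
        have := X.size_labeling_le
        rw [Fintype.card_fin] at this
        exact_mod_cast this.trans (Nat.add_le_add_left hmid _)
      have h1 : (X.S.card : ℝ) * n ≤ 2 * √((n : ℝ) * Real.log n) * n :=
        mul_le_mul_of_nonneg_right (hScard.trans hmin) (by positivity)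
      calc (X.labeling.size : ℝ) ≤ 4 * √((n : ℝ) * Real.log n) * n := by nlinarith
        _ ≤ 4 * √((n : ℝ) * Real.log n) * (2 * mu.size) :=
          mul_le_mul_of_nonneg_left hopt (by positivity)
        _ = _ := by ring

/-- Here `c = 0`, so T is the whole vertex set only together with S = B. The program compares the
cost bounds n k and |A|² D, hence the middle labels are bounded by their minimum. The constant is 20
= 10 · 2. -/
theorem hasPolyTimeApprox_cbrt : HasPolyTimeApprox
    (fun _ G a => ⌈(5 / 3 : ℝ) * (G.diam : ℝ)⌉ ≤ (a : ℤ))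
    (fun n G => ((G.diam : ℝ) * (n : ℝ) * Real.log n ^ 2) ^ (1 / 3 : ℝ)) := by
  classical
  refine ⟨mainProg 3 costCond 0, (mainCmd 3 costCond 0).time +
    (triplesIn.time + (triplesMid.time + (triplesOut.time + 2))), 20, ?_⟩
  intro n G a hG ha
  obtain ⟨k, A, X, hk, hA, hdom, hS1, hS2, hT1, hT2, hmid1, hmid2, s, t, hex, ht, hout⟩ :=
    exists_scheme hG a (show 2 ≤ 3 by omega) (cond := costCond) (c := 0)
      (C := fun b g D => n * b ≤ g * g * D) (fun M B A hB hA hD => val_costCond hB hA hD _)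
  simp only [ne_eq, not_true_eq_false, or_false] at hT1 hT2
  have hdiam : 5 * G.diam ≤ 3 * a := by
    have h1 : (5 / 3 : ℝ) * G.diam ≤ a := by exact_mod_cast Int.ceil_le.1 ha
    have : (5 : ℝ) * G.diam ≤ 3 * a := by linarith
    exact_mod_cast this
  refine ⟨s, t, hex, ht, X.labeling, hout, X.feasible_labeling hG fun x => ?_, fun mu hmu => ?_⟩
  -- With the ball, the lifetime bound is 2 D - ⌊D / 3⌋ = ⌈5 D / 3⌉; with S = T = A it is D + 2 ⌊D /
  -- 3⌋ ≤ 5 D / 3.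
  · by_cases h : n * k ≤ A.card * A.card * G.diam
    · obtain ⟨hT, hr⟩ := hT1 h
      have : setDist G X.T x = 0 := (setDist_eq_zero hG X.T_nonempty).2 (by rw [hT]; simp)
      omega
    · obtain ⟨hT, hr⟩ := hT2 h
      have := hdom x
      rw [hT, hr]
      omega
  · rcases le_or_gt n 1 with hn | hn
    · rw [size_eq_zero_of_card_le_one hn, Nat.cast_zero]
      have := Real.log_natCast_nonneg n
      positivity
    · have hn2 : (2 : ℝ) ≤ n := by exact_mod_cast hn
      have hopt := card_sub_one_le hG hn hmu
      have hD1 : 1 ≤ G.diam := by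
        have : Nontrivial (Fin n) := Fin.nontrivial_iff_two_le.2 hn
        exact Nat.one_le_iff_ne_zero.2 (SimpleGraph.connected_iff_diam_ne_zero.1 hG)
      have hDn : G.diam ≤ n := by
        have := diam_lt_card hG
        rw [Fintype.card_fin] at this
        exact this.le
      have hmin := min_le_mul_cbrt hn2 (Nat.cast_pos.2 hk) (Nat.cast_nonneg A.card) hA
        (by exact_mod_cast hD1) (show (G.diam : ℝ) ≤ n by exact_mod_cast hDn)
      have hmid : (X.mid.card : ℝ) ≤ min ((n : ℝ) * k) (A.card * A.card * G.diam) := by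
        by_cases h : n * k ≤ A.card * A.card * G.diam
        · rw [min_eq_left (by exact_mod_cast h)]
          rw [hS1 h, mul_comm] at hmid1
          exact_mod_cast hmid1
        · rw [min_eq_right (by exact_mod_cast (not_le.1 h).le)]
          rw [hS2 h, (hT2 h).1, ← mul_assoc] at hmid2
          exact_mod_cast hmid2
      have hsize : (X.labeling.size : ℝ) ≤ 2 * n + X.mid.card := by
        have := X.size_labeling_le
        rw [Fintype.card_fin] at this
        exact_mod_cast this
      set K := ((G.diam : ℝ) * (n : ℝ) * Real.log n ^ 2) ^ (1 / 3 : ℝ) with hK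
      have hK0 : 0 ≤ K := Real.rpow_nonneg (by positivity) _
      calc (X.labeling.size : ℝ) ≤ 10 * n * K := by linarith
        _ = 10 * K * n := by ring
        _ ≤ 10 * K * (2 * mu.size) := mul_le_mul_of_nonneg_left hopt (by positivity)
        _ = _ := by ring

end AgedLabeling

theorem mainTheorem3 :
    AgedLabeling.HasPolyTimeApprox
      (fun _ G a => ⌈(3 / 2 : ℝ) * (G.diam : ℝ)⌉ ≤ (a : ℤ))
      (fun n _ => Real.sqrt ((n : ℝ) * Real.log n)) ∧
    AgedLabeling.HasPolyTimeApprox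
      (fun _ G a => ⌈(5 / 3 : ℝ) * (G.diam : ℝ)⌉ ≤ (a : ℤ))
      (fun n G => ((G.diam : ℝ) * (n : ℝ) * Real.log n ^ 2) ^ (1 / 3 : ℝ)) :=
  ⟨AgedLabeling.hasPolyTimeApprox_sqrt, AgedLabeling.hasPolyTimeApprox_cbrt⟩
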